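/- Let $N\ge 1$ and let $q,Q$ be nonzero elements of a field $K$ (for instance $K=\mathbb{C}$, or $K=\mathbb{C}(q,Q)$ with $q,Q$ indeterminates). Put $[m]=\sum_{i=0}^{m-1}q^{m-1-2i}$. Let $V_1=Kv_1\oplus Kv_{-1}$ and let $e_1,\dots,e_N$ act on $V_1^{\otimes N}$ as follows: for $1\le i\le N-1$, $e_i$ acts on the tensor factors $i,i+1$ by $$\begin{pmatrix}0&0&0&0\\0&-q^{-1}&1&0\\0&1&-q&0\\0&0&0&0\end{pmatrix}$$ in the basis $(v_1\otimes v_1,\,v_1\otimes v_{-1},\,v_{-1}\otimes v_1,\,v_{-1}\otimes v_{-1})$, and $e_N$ acts on the last factor by $\begin{pmatrix}-Q^{-1}&1\\1&-Q\end{pmatrix}$ in the basis $(v_1,v_{-1})$; all other factors are left fixed. For $a_N\in K$ let $H^{1B}=-\sum_{i=1}^{N-1}e_i-a_Ne_N$ be the one-boundary Temperley--Lieb Hamiltonian. To a binary string $b\in\{+,-\}^N$ associate a diagram $D$: write $\uparrow$ for $+$ and $\downarrow$ for $-$, and repeatedly join a down arrow to an up arrow next to it on its right by an arc, disregarding arrows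 already joined, until no such pair is left. Let $S$, $S_\uparrow$, $S_\downarrow$ be the sets of arcs, of unpaired up arrows and of unpaired down arrows. The type A Kazhdan--Lusztig basis vector of $D$, also denoted $D$, is the tensor product in which each arc contributes $v_{-1}\otimes v_1-q^{-1}v_1\otimes v_{-1}$ at its two end sites, each unpaired up arrow $v_1$ and each unpaired down arrow $v_{-1}$. Put $d=|S_\uparrow|+|S|$ and $$\Psi_D=q^{d(d-1)/2}Q^d\prod_{A\in S\cup S_\downarrow}[N_A]\ \prod_{B\in S}[m_B]^{-1}\prod_{C\in S_\downarrow}[N'_C]^{-1},\qquad \Psi=\sum_D\Psi_D\,D .$$ Here $N_A$ is the number of $A$ when unpaired up arrows, unpaired down arrows and arcs (arcs by their left ends) are enumerated together from left to right by $1,2,\dots$; $m_B=(j-i+1)/2$ for an arc $B$ joining the sites $i<j$; and $N'_C$ is the number of $C$ when unpaired down arrows and arcs are enumerated together from right to left by $1,2,\dots$. (1) If $[m]\ne0$ for $1\le m\le N$ (so that $\Psi$ is defined), then $e_i\Psi=0$ for all $1\le i\le N-1$ and $e_N\Psi=0$. Moreover $\Psi\neq0$, and $\Psi$ is an eigenvector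 of $H^{1B}$ with eigenvalue $0$, for every $a_N\in K$. (2) For arbitrary nonzero $q,Q\in\mathbb{C}$ (roots of unity $q$ included) the limits $c_D=\lim_{z\to q,\,z\ne q}\Psi_D(z,Q)$ exist, and the conclusions of (1) hold with $\Psi$ replaced by $\sum_D c_D\,D$, for every $a_N\in\mathbb{C}$. -/

import Mathlib

open Finset Filter Topology

noncomputable section

namespace OneBoundaryTL

/-- Binary strings of length `N`, indexing the standard basis of the `N`-fold tensor power of
`V₁ = ⟨v₁, v₋₁⟩`. The value `0` stands for `v₁` (sign `+`, up arrow), the value `1` for `v₋₁`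
(sign `-`, down arrow), in agreement with the order `(v₁, v₋₁)` of the basis of `V₁`. -/
abbrev Config (N : ℕ) : Type := Fin N → Fin 2

/-- The space `V₁^{⊗N}` over `K`, in coordinates with respect to the standard basis. -/
abbrev Space (K : Type*) (N : ℕ) : Type _ := Config N → K

section Generators

variable {K : Type*} [Field K]

/-- The `4 × 4` matrix of a bulk generator, in the basis
`(v₁ ⊗ v₁, v₁ ⊗ v₋₁, v₋₁ ⊗ v₁, v₋₁ ⊗ v₋₁)` of `V₁ ⊗ V₁`. -/
def bulkBlock (q : K) : Matrix (Fin 2 × Fin 2) (Fin 2 × Fin 2) K :=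
  (!![0, 0, 0, 0;
      0, -q⁻¹, 1, 0;
      0, 1, -q, 0;
      0, 0, 0, 0] : Matrix (Fin 4) (Fin 4) K).submatrix finProdFinEquiv finProdFinEquiv

/-- The `2 × 2` matrix of the boundary generator, in the basis `(v₁, v₋₁)` of `V₁`. -/
def boundaryBlock (Q : K) : Matrix (Fin 2) (Fin 2) K :=
  !![-Q⁻¹, 1;
     1, -Q]

/-- The bulk Temperley–Lieb generators of a system with `N = n + 1` sites. For `i : Fin n` this is
`e_{i+1}`: it acts as `bulkBlock q` on the adjacent sites `i.castSucc`, `i.succ` (counted from `0`)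
and as the identity on all other sites. -/
def bulkGen {n : ℕ} (q : K) (i : Fin n) : Matrix (Config (n + 1)) (Config (n + 1)) K :=
  fun κ κ' =>
    bulkBlock q (κ i.castSucc, κ i.succ) (κ' i.castSucc, κ' i.succ) *
      if ∀ k, k ≠ i.castSucc → k ≠ i.succ → κ k = κ' k then 1 else 0

/-- The boundary generator `e_N`, `N = n + 1`: it acts as `boundaryBlock Q` on the last site and
as the identity on all other sites. -/
def boundaryGen {n : ℕ} (Q : K) : Matrix (Config (n + 1)) (Config (n + 1)) K :=
  fun κ κ' =>
    boundaryBlock Q (κ (Fin.last n)) (κ' (Fin.last n)) *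
      if ∀ k, k ≠ Fin.last n → κ k = κ' k then 1 else 0

/-- The one-boundary Temperley–Lieb Hamiltonian `H = -∑_{i=1}^{N-1} e_i - a_N e_N`, `N = n + 1`. -/
def hamiltonian (n : ℕ) (q Q a : K) : Matrix (Config (n + 1)) (Config (n + 1)) K :=
  -(∑ i : Fin n, bulkGen q i) - a • boundaryGen Q

end Generators

section Diagrams

variable {N : ℕ}

/-- The number of up arrows at the sites from `i` to `j` (inclusive). -/
def numUp (b : Config N) (i j : Fin N) : ℕ := #{l ∈ Finset.Icc i j | b l = 0}

/-- The number of down arrows at the sites from `i` to `j` (inclusive). -/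
def numDown (b : Config N) (i j : Fin N) : ℕ := #{l ∈ Finset.Icc i j | b l = 1}

/-- The sites `i < j` are joined by an arc of the diagram of `b`. Repeatedly joining a down arrow to
an up arrow next to it on the right (arrows already joined being disregarded) is the matching of
opening brackets (down arrows) with closing brackets (up arrows): `j` is the first site
at which the brackets opened from site `i` on are all closed. -/
def IsArc (b : Config N) (i j : Fin N) : Prop :=
  i < j ∧ (∀ k, i ≤ k → k < j → numUp b i k < numDown b i k) ∧ numUp b i j = numDown b i j

instance (b : Config N) (i j : Fin N) : Decidable (IsArc b i j) := by
  unfold IsArc; infer_instance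

/-- The set `S` of arcs, an arc being given by its left and right end sites. -/
def arcs (b : Config N) : Finset (Fin N × Fin N) := {p | IsArc b p.1 p.2}

/-- The set of sites carrying an unpaired up arrow. -/
def upArrows (b : Config N) : Finset (Fin N) := {i | b i = 0 ∧ ∀ j, ¬ IsArc b j i}

/-- The set of sites carrying an unpaired down arrow. -/
def downArrows (b : Config N) : Finset (Fin N) := {i | b i = 1 ∧ ∀ j, ¬ IsArc b i j}

/-- Enumerate unpaired up arrows, unpaired down arrows and arcs together from left to right by
`1, 2, …`, arcs according to their left ends (so an arc precedes the arcs inside it). This is the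
number of the object which is, or whose left end is, at site `i`. -/
def labelLeft (b : Config N) (i : Fin N) : ℕ :=
  #{j ∈ upArrows b | j ≤ i} + #{j ∈ downArrows b | j ≤ i} + #{p ∈ arcs b | p.1 ≤ i}

/-- Enumerate unpaired down arrows and arcs together from right to left by `1, 2, …`. This is the
number of the unpaired down arrow at site `i`. -/
def labelRight (b : Config N) (i : Fin N) : ℕ :=
  #{j ∈ downArrows b | i ≤ j} + #{p ∈ arcs b | i ≤ p.2}

/-- The size `(j - i + 1) / 2` of the arc joining the sites `i < j` (the division is exact). -/
def arcSize (p : Fin N × Fin N) : ℕ := ((p.2 : ℕ) - (p.1 : ℕ) + 1) / 2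

variable {K : Type*} [Field K]

/-- The quantum integer `[n] = ∑_{i=0}^{n-1} q^{n-1-2i}`. -/
def qInt (q : K) (n : ℕ) : K := ∑ i ∈ Finset.range n, q ^ ((n : ℤ) - 1 - 2 * (i : ℤ))

/-- The coordinates in `V₁ ⊗ V₁` of the vector `v₋₁ ⊗ v₁ - q⁻¹ v₁ ⊗ v₋₁` of an arc: the entry
`(ε, ε')` is the coefficient of `v_ε ⊗ v_ε'`. -/
def arcVec (q : K) : Matrix (Fin 2) (Fin 2) K :=
  !![0, -q⁻¹;
     1, 0]

/-- The type A Kazhdan–Lusztig basis vector indexed by `b`: the tensor product over the building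
blocks of the diagram of `b`, where an arc is the vector `arcVec q` (placed at its two end sites),
an unpaired up arrow is `v₁` and an unpaired down arrow is `v₋₁`. -/
def klVec (q : K) (b : Config N) : Space K N := fun κ =>
  (∏ p ∈ arcs b, arcVec q (κ p.1) (κ p.2)) *
    ∏ i ∈ upArrows b ∪ downArrows b, if κ i = b i then 1 else 0

/-- The component `Ψ_D = N₁ N₂ N₃ N₄` of `Ψ`, for the diagram `D` of `b`. -/
def psiCoeff (q Q : K) (b : Config N) : K :=
  let d := #(upArrows b) + #(arcs b)
  let N₁ := q ^ (d * (d - 1) / 2) * Q ^ d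
  let N₂ := (∏ p ∈ arcs b, qInt q (labelLeft b p.1)) * ∏ i ∈ downArrows b, qInt q (labelLeft b i)
  let N₃ := ∏ p ∈ arcs b, (qInt q (arcSize p))⁻¹
  let N₄ := ∏ i ∈ downArrows b, (qInt q (labelRight b i))⁻¹
  N₁ * N₂ * N₃ * N₄

/-- The vector `∑_D c_D D` of `V₁^{⊗N}` with components `c_D` in the Kazhdan–Lusztig basis. -/
def klCombination (q : K) (c : Config N → K) : Space K N := ∑ b, c b • klVec q b

/-- The vector `Ψ = ∑_D Ψ_D D`. -/
def Psi (N : ℕ) (q Q : K) : Space K N := klCombination q (psiCoeff q Q)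

end Diagrams

/-- `v` is annihilated by all generators `e_1, …, e_N`, `N = n + 1`, and is an eigenvector
(in particular nonzero) with eigenvalue `0` of the one-boundary Hamiltonian, for all values of the
coupling `a_N`. -/
def IsZeroMode {K : Type*} [Field K] (n : ℕ) (q Q : K) (v : Space K (n + 1)) : Prop :=
  (∀ i : Fin n, (bulkGen q i).mulVec v = 0) ∧
    (boundaryGen Q).mulVec v = 0 ∧
    ∀ a : K, Module.End.HasEigenvector (Matrix.toLin' (hamiltonian n q Q a)) 0 v

end OneBoundaryTL

end

namespace OneBoundaryTL

section Heights

/-- The height before site `t` of the lattice path with down steps at `S` and up steps elsewhere. -/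
def height (S : Finset ℕ) (t : ℕ) : ℤ := t - 2 * (#{x ∈ S | x < t} : ℤ)

/-- The path has not been higher than it is before site `t`. -/
def IsRecord (S : Finset ℕ) (t : ℕ) : Prop := ∀ x ≤ t, height S x ≤ height S t

/-- Site `t` carries an unpaired up arrow. -/
def IsUp (S : Finset ℕ) (t : ℕ) : Prop := t ∉ S ∧ IsRecord S t

noncomputable instance (S : Finset ℕ) : DecidablePred (IsRecord S) := Classical.decPred _

noncomputable instance (S : Finset ℕ) : DecidablePred (IsUp S) := Classical.decPred _

/-- The sites `i < j` are joined by an arc. -/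
def IsChord (S : Finset ℕ) (i j : ℕ) : Prop :=
  i < j ∧ (∀ k, i < k → k ≤ j → height S k < height S i) ∧ height S (j + 1) = height S i

/-- The right end of the arc starting at `i ∈ S`, in the chain continued by up arrows. -/
noncomputable def mate (S : Finset ℕ) (i : ℕ) : ℕ :=
  sInf {j | i < j ∧ height S i ≤ height S (j + 1)}

variable {S : Finset ℕ} {i j t u x : ℕ}

lemma card_filter_lt_succ_of_mem (h : t ∈ S) : #{x ∈ S | x < t + 1} = #{x ∈ S | x < t} + 1 := by
  have : {x ∈ S | x < t + 1} = insert t {x ∈ S | x < t} := by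
    ext x; simp only [mem_filter, mem_insert]
    constructor
    · rintro ⟨h1, h2⟩
      rcases Nat.lt_succ_iff_lt_or_eq.1 h2 with h3 | h3
      · exact Or.inr ⟨h1, h3⟩
      · exact Or.inl h3
    · rintro (rfl | ⟨h1, h2⟩)
      · exact ⟨h, by omega⟩
      · exact ⟨h1, by omega⟩
  rw [this, card_insert_of_notMem (by simp)]

lemma card_filter_lt_succ_of_notMem (h : t ∉ S) : #{x ∈ S | x < t + 1} = #{x ∈ S | x < t} := by
  congr 1; ext x; simp only [mem_filter]
  constructor
  · rintro ⟨h1, h2⟩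
    exact ⟨h1, lt_of_le_of_ne (by omega) (by rintro rfl; exact h h1)⟩
  · rintro ⟨h1, h2⟩
    exact ⟨h1, by omega⟩

lemma height_succ_of_mem (h : t ∈ S) : height S (t + 1) = height S t - 1 := by
  unfold height; rw [card_filter_lt_succ_of_mem h]; push_cast; ring

lemma height_succ_of_notMem (h : t ∉ S) : height S (t + 1) = height S t + 1 := by
  unfold height; rw [card_filter_lt_succ_of_notMem h]; push_cast; ring

lemma height_succ_le : height S (t + 1) ≤ height S t + 1 := by
  by_cases h : t ∈ S
  · rw [height_succ_of_mem h]; omega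
  · rw [height_succ_of_notMem h]

lemma IsChord.left_mem (h : IsChord S i j) : i ∈ S := by
  by_contra hi
  have := h.2.1 (i + 1) (by omega) h.1
  rw [height_succ_of_notMem hi] at this; omega

lemma IsChord.right_notMem (h : IsChord S i j) : j ∉ S := by
  intro hj
  have h1 := h.2.1 j h.1 le_rfl
  have h2 := h.2.2
  rw [height_succ_of_mem hj] at h2; omega

lemma IsChord.height_right (h : IsChord S i j) : height S j = height S i - 1 := by
  have := h.2.2
  rw [height_succ_of_notMem h.right_notMem] at this; omega

lemma IsChord.mate_eq (h : IsChord S i j) : mate S i = j := by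
  apply le_antisymm
  · exact Nat.sInf_le ⟨h.1, h.2.2.ge⟩
  · have hj : j ∈ {j | i < j ∧ height S i ≤ height S (j + 1)} := ⟨h.1, h.2.2.ge⟩
    refine le_csInf ⟨j, hj⟩ ?_
    rintro k ⟨h1, h2⟩
    by_contra hk
    exact absurd (h.2.1 (k + 1) (by omega) (by omega)) (by omega)

lemma isChord_mate (hi : i ∈ S) : IsChord S i (mate S i) := by
  have hne : {j | i < j ∧ height S i ≤ height S (j + 1)}.Nonempty := by
    refine ⟨i + 2 * #S + 1, by omega, ?_⟩
    unfold height
    have : #{x ∈ S | x < i + 2 * #S + 1 + 1} ≤ #S := card_filter_le _ _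
    push_cast; omega
  have hm : i < mate S i ∧ height S i ≤ height S (mate S i + 1) := Nat.sInf_mem hne
  have hlt : ∀ k, i < k → k ≤ mate S i → height S k < height S i := by
    intro k hk hk'
    by_contra hcon
    obtain ⟨l, rfl⟩ : ∃ l, k = l + 1 := ⟨k - 1, by omega⟩
    rcases Nat.eq_or_lt_of_le (Nat.lt_succ_iff.1 hk) with rfl | hl
    · rw [height_succ_of_mem hi] at hcon; omega
    · have : mate S i ≤ l := Nat.sInf_le ⟨hl, by omega⟩
      omega
  refine ⟨hm.1, hlt, le_antisymm ?_ hm.2⟩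
  have h1 := hlt _ hm.1 le_rfl
  have h2 := height_succ_le (S := S) (t := mate S i)
  omega

lemma IsChord.isRecord_succ (h : IsChord S i j) (hi : IsRecord S i) : IsRecord S (j + 1) := by
  intro x hx
  rw [h.2.2]
  rcases le_or_gt x i with h1 | h1
  · exact hi x h1
  · rcases Nat.eq_or_lt_of_le hx with rfl | h2
    · exact h.2.2.le
    · exact (h.2.1 x h1 (by omega)).le

lemma IsChord.not_isRecord (h : IsChord S i j) (h1 : i < x) (h2 : x ≤ j) : ¬ IsRecord S x := by
  intro hx
  exact absurd (h.2.1 x h1 h2) (not_lt.2 (hx i h1.le))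

lemma IsChord.lt_of_isRecord (h : IsChord S i j) (hx : IsRecord S x) (h1 : i < x) : j < x := by
  by_contra h2
  exact h.not_isRecord h1 (not_lt.1 h2) hx

lemma IsUp.isRecord_succ (h : IsUp S t) : IsRecord S (t + 1) := by
  intro x hx
  rw [height_succ_of_notMem h.1]
  rcases Nat.eq_or_lt_of_le hx with rfl | h2
  · rw [height_succ_of_notMem h.1]
  · have := h.2 x (by omega); omega

lemma isRecord_zero : IsRecord S 0 := by
  intro x hx; rw [Nat.le_zero.1 hx]

/-- Every site is an unpaired up arrow or an end of an arc. -/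
lemma exists_isChord_of_not_isUp (h1 : t ∉ S) (h2 : ¬ IsUp S t) : ∃ i, IsChord S i t := by
  have h3 : ¬ IsRecord S t := fun h => h2 ⟨h1, h⟩
  unfold IsRecord at h3
  push Not at h3
  let P : ℕ → Prop := fun x => x ≤ t ∧ height S t < height S x
  classical
  have hex : ∃ x ≤ t, P x := by
    obtain ⟨x, hx, hx'⟩ := h3
    exact ⟨x, hx, hx, hx'⟩
  obtain ⟨x, hx, hP⟩ := hex
  have hg := Nat.findGreatest_spec hx hP
  set i := Nat.findGreatest P t with hidef
  have hmax : ∀ k, i < k → k ≤ t → height S k ≤ height S t := by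
    intro k hk hkt
    by_contra hc
    exact Nat.findGreatest_is_greatest hk hkt ⟨hkt, not_le.1 hc⟩
  have hit : i < t := by
    rcases Nat.eq_or_lt_of_le hg.1 with h | h
    · have := hg.2; rw [h] at this; omega
    · exact h
  have hi1 := hmax (i + 1) (by omega) (by omega)
  have hi : i ∈ S := by
    by_contra hi
    rw [height_succ_of_notMem hi] at hi1
    have := hg.2; omega
  rw [height_succ_of_mem hi] at hi1
  have := hg.2
  refine ⟨i, hit, fun k hk hk' => lt_of_le_of_lt (hmax k hk hk') hg.2, ?_⟩
  rw [height_succ_of_notMem h1]; omega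

lemma height_erase_of_le (h : x ≤ i) : height (S.erase i) x = height S x := by
  unfold height
  have : {y ∈ S.erase i | y < x} = {y ∈ S | y < x} := by
    ext y; simp only [mem_filter, mem_erase]
    constructor
    · rintro ⟨⟨_, h1⟩, h2⟩; exact ⟨h1, h2⟩
    · rintro ⟨h1, h2⟩; exact ⟨⟨by omega, h1⟩, h2⟩
  rw [this]

lemma height_erase_of_lt (hi : i ∈ S) (h : i < x) : height (S.erase i) x = height S x + 2 := by
  unfold height
  rw [filter_erase, card_erase_of_mem (by simp [hi, h])]
  have : 0 < #{y ∈ S | y < x} := card_pos.2 ⟨i, by simp [hi, h]⟩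
  push_cast [Nat.cast_sub (Nat.succ_le_of_lt this)]; ring

lemma isRecord_erase_of_le (h : x ≤ i) : IsRecord (S.erase i) x ↔ IsRecord S x := by
  unfold IsRecord
  refine forall₂_congr fun y hy => ?_
  rw [height_erase_of_le h, height_erase_of_le (hy.trans h)]

/-- Reversing the left end of an outermost arc frees both of its ends. -/
lemma isUp_erase (h : IsChord S i j) (hi : IsRecord S i) :
    IsUp (S.erase i) x ↔ IsUp S x ∨ x = i ∨ x = j := by
  have hiS := h.left_mem
  rcases lt_trichotomy x i with hx | rfl | hx
  · have hxj : x ≠ j := by have := h.1; omega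
    simp only [IsUp, isRecord_erase_of_le hx.le, mem_erase, hx.ne, hxj, ne_eq, not_false_eq_true,
      true_and, or_false]
  · simp [IsUp, isRecord_erase_of_le (S := S) le_rfl, hi]
  · have hxS : x ∉ S.erase i ↔ x ∉ S := by simp [hx.ne']
    rcases lt_trichotomy x j with hxj | rfl | hxj
    · constructor
      · rintro ⟨h1, h2⟩
        exfalso
        have h3 := h2 (i + 1) hx
        rw [height_erase_of_lt hiS hx, height_erase_of_lt hiS (by omega),
          height_succ_of_mem hiS] at h3
        have h4 := h.2.1 (x + 1) (by omega) (by omega)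
        rw [height_succ_of_notMem (hxS.1 h1)] at h4
        omega
      · rintro (h1 | h1 | h1)
        · exact absurd h1.2 (h.not_isRecord hx hxj.le)
        · omega
        · omega
    · refine ⟨fun _ => by simp, fun _ => ⟨hxS.2 h.right_notMem, fun y hy => ?_⟩⟩
      rw [height_erase_of_lt hiS hx, h.height_right]
      rcases le_or_gt y i with hy' | hy'
      · rw [height_erase_of_le hy']; have := hi y hy'; omega
      · rw [height_erase_of_lt hiS hy']; have := h.2.1 y hy' hy; omega
    · have : IsRecord (S.erase i) x ↔ IsRecord S x := by
        constructor
        · intro h1 y hy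
          have h2 := h1 (j + 1) hxj
          rw [height_erase_of_lt hiS hx, height_erase_of_lt hiS (by have := h.1; omega),
            h.2.2] at h2
          rcases le_or_gt y i with hy' | hy'
          · have := hi y hy'; omega
          · have := h1 y hy
            rw [height_erase_of_lt hiS hx, height_erase_of_lt hiS hy'] at this; omega
        · intro h1 y hy
          have := h1 y hy
          rw [height_erase_of_lt hiS hx]
          rcases le_or_gt y i with hy' | hy'
          · rw [height_erase_of_le hy']; omega
          · rw [height_erase_of_lt hiS hy']; omega
      simp only [IsUp, hxS, this, hx.ne', hxj.ne', or_false]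

lemma mate_erase (hi : i ∈ S) (hr : IsRecord S i) (hx : x ∈ S) (hxi : x ≠ i) :
    mate (S.erase i) x = mate S x := by
  have hc := isChord_mate hx
  apply IsChord.mate_eq
  rcases lt_or_gt_of_ne hxi with h | h
  · have hm := hc.lt_of_isRecord hr h
    refine ⟨hc.1, fun k hk hk' => ?_, ?_⟩
    · rw [height_erase_of_le (by omega), height_erase_of_le (by omega)]; exact hc.2.1 k hk hk'
    · rw [height_erase_of_le (by omega), height_erase_of_le (by omega)]; exact hc.2.2
  · have := hc.1
    refine ⟨hc.1, fun k hk hk' => ?_, ?_⟩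
    · rw [height_erase_of_lt hi (by omega), height_erase_of_lt hi (by omega)]
      have := hc.2.1 k hk hk'; omega
    · rw [height_erase_of_lt hi (by omega), height_erase_of_lt hi (by omega), hc.2.2]

/-- The number of unpaired up arrows before site `t`. -/
noncomputable def upsBefore (S : Finset ℕ) (t : ℕ) : ℕ := #{x ∈ range t | IsUp S x}

/-- The number of arcs and unpaired up arrows starting before site `t`. -/
noncomputable def startsBefore (S : Finset ℕ) (t : ℕ) : ℕ := upsBefore S t + #{x ∈ S | x < t}

/-- The size of the arc starting at `i`. -/
noncomputable def chordSize (S : Finset ℕ) (i : ℕ) : ℕ := #{x ∈ S | i ≤ x ∧ x ≤ mate S i}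

lemma upsBefore_erase_of_le (h : t ≤ i) : upsBefore (S.erase i) t = upsBefore S t := by
  unfold upsBefore
  congr 1; ext x; simp only [mem_filter, mem_range]
  refine and_congr_right fun hx => ?_
  have : x ≠ i := by omega
  simp only [IsUp, mem_erase]
  rw [isRecord_erase_of_le (by omega)]; simp [this]

lemma upsBefore_erase_of_le_right (h : IsChord S i j) (hi : IsRecord S i) (h1 : i < t)
    (h2 : t ≤ j) : upsBefore (S.erase i) t = upsBefore S t + 1 := by
  unfold upsBefore
  have : {x ∈ range t | IsUp (S.erase i) x} = insert i {x ∈ range t | IsUp S x} := by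
    ext x; simp only [mem_filter, mem_range, isUp_erase h hi, mem_insert]
    constructor
    · rintro ⟨h3, h4 | h4 | h4⟩
      · exact Or.inr ⟨h3, h4⟩
      · exact Or.inl h4
      · omega
    · rintro (h3 | h3)
      · exact ⟨by omega, by simp [h3]⟩
      · exact ⟨h3.1, Or.inl h3.2⟩
  rw [this, card_insert_of_notMem]
  exact fun hm => (mem_filter.1 hm).2.1 h.left_mem

lemma upsBefore_erase_of_right_lt (h : IsChord S i j) (hi : IsRecord S i) (h2 : j < t) :
    upsBefore (S.erase i) t = upsBefore S t + 2 := by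
  unfold upsBefore
  have hij := h.1
  have : {x ∈ range t | IsUp (S.erase i) x} = insert i (insert j {x ∈ range t | IsUp S x}) := by
    ext x; simp only [mem_filter, mem_range, isUp_erase h hi, mem_insert]
    constructor
    · rintro ⟨h3, h4 | h4 | h4⟩
      · exact Or.inr (Or.inr ⟨h3, h4⟩)
      · exact Or.inl h4
      · exact Or.inr (Or.inl h4)
    · rintro (h3 | h3 | h3)
      · exact ⟨by omega, by simp [h3]⟩
      · exact ⟨by omega, by simp [h3]⟩
      · exact ⟨h3.1, Or.inl h3.2⟩
  rw [this, card_insert_of_notMem, card_insert_of_notMem]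
  · exact fun hm => h.not_isRecord hij le_rfl (mem_filter.1 hm).2.2
  · rw [mem_insert, not_or]
    exact ⟨hij.ne, fun hm => (mem_filter.1 hm).2.1 h.left_mem⟩

lemma card_filter_lt_erase_of_le (h : t ≤ i) :
    #{x ∈ S.erase i | x < t} = #{x ∈ S | x < t} := by
  rw [filter_erase, erase_eq_of_notMem (by simp; omega)]

lemma card_filter_lt_erase_of_lt (hi : i ∈ S) (h : i < t) :
    #{x ∈ S.erase i | x < t} + 1 = #{x ∈ S | x < t} := by
  rw [filter_erase, card_erase_add_one (by simp [hi, h])]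

lemma startsBefore_erase_of_le (h : IsChord S i j) (hi : IsRecord S i) (h1 : t ≤ j) :
    startsBefore (S.erase i) t = startsBefore S t := by
  unfold startsBefore
  rcases le_or_gt t i with h2 | h2
  · rw [upsBefore_erase_of_le h2, card_filter_lt_erase_of_le h2]
  · have := card_filter_lt_erase_of_lt h.left_mem h2
    rw [upsBefore_erase_of_le_right h hi h2 h1]; omega

lemma startsBefore_erase_of_lt (h : IsChord S i j) (hi : IsRecord S i) (h1 : j < t) :
    startsBefore (S.erase i) t = startsBefore S t + 1 := by
  unfold startsBefore
  have := card_filter_lt_erase_of_lt h.left_mem (h.1.trans h1)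
  rw [upsBefore_erase_of_right_lt h hi h1]; omega

lemma chordSize_erase (hi : i ∈ S) (hr : IsRecord S i) (hx : x ∈ S) (hxi : x ≠ i) :
    chordSize (S.erase i) x = chordSize S x := by
  unfold chordSize
  rw [mate_erase hi hr hx hxi]
  congr 1; ext y; simp only [mem_filter, mem_erase]
  constructor
  · rintro ⟨⟨_, h⟩, h'⟩; exact ⟨h, h'⟩
  · rintro ⟨h1, h2, h3⟩
    refine ⟨⟨?_, h1⟩, h2, h3⟩
    rintro rfl
    have := (isChord_mate hx).lt_of_isRecord hr (by omega)
    omega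

lemma upsBefore_succ (h : IsUp S t) : upsBefore S (t + 1) = upsBefore S t + 1 := by
  unfold upsBefore
  rw [range_add_one, filter_insert, if_pos h, card_insert_of_notMem (by simp)]

lemma upsBefore_eq_of_forall_not (h : t ≤ u) (h' : ∀ x, t ≤ x → x < u → ¬ IsUp S x) :
    upsBefore S u = upsBefore S t := by
  unfold upsBefore
  congr 1; ext x; simp only [mem_filter, mem_range]
  constructor
  · rintro ⟨h1, h2⟩
    refine ⟨?_, h2⟩
    by_contra h3
    exact h' x (by omega) h1 h2
  · rintro ⟨h1, h2⟩; exact ⟨by omega, h2⟩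

/-- Inside an outermost arc only arcs start. -/
lemma startsBefore_of_mem_chord (h : IsChord S i j) (h1 : i < x)
    (h2 : x ≤ j) :
    startsBefore S x = startsBefore S i + 1 + #{y ∈ {y ∈ S | i < y ∧ y ≤ j} | y < x} := by
  unfold startsBefore
  have hu : upsBefore S x = upsBefore S i := by
    apply upsBefore_eq_of_forall_not h1.le
    intro y hy hy' hup
    rcases Nat.eq_or_lt_of_le hy with rfl | hy
    · exact hup.1 h.left_mem
    · exact h.not_isRecord hy (by omega) hup.2
  have : {y ∈ S | y < x} = {y ∈ S | y < i} ∪ insert i {y ∈ {y ∈ S | i < y ∧ y ≤ j} | y < x} := by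
    ext y; simp only [mem_filter, mem_union, mem_insert]
    constructor
    · rintro ⟨h3, h4⟩
      rcases lt_trichotomy y i with h5 | h5 | h5
      · exact Or.inl ⟨h3, h5⟩
      · exact Or.inr (Or.inl h5)
      · exact Or.inr (Or.inr ⟨⟨h3, h5, by omega⟩, h4⟩)
    · rintro (h3 | rfl | h3)
      · exact ⟨h3.1, by omega⟩
      · exact ⟨h.left_mem, h1⟩
      · exact ⟨h3.1.1, h3.2⟩
  rw [hu, this, card_union_of_disjoint, card_insert_of_notMem (by simp)]
  · ring
  · rw [disjoint_left]; intro y hy; simp only [mem_filter, mem_insert] at hy ⊢; omega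

end Heights

section Shift

/-- The set of down arrows after an up arrow has been put in front. -/
def shiftSet (S : Finset ℕ) : Finset ℕ := S.map ⟨Nat.succ, Nat.succ_injective⟩

variable {S : Finset ℕ} {i j t u x : ℕ}

@[simp] lemma succ_mem_shiftSet : x + 1 ∈ shiftSet S ↔ x ∈ S := by simp [shiftSet]

@[simp] lemma zero_notMem_shiftSet : 0 ∉ shiftSet S := by simp [shiftSet]

@[simp] lemma card_shiftSet : #(shiftSet S) = #S := card_map _

lemma card_filter_lt_shiftSet : #{x ∈ shiftSet S | x < t + 1} = #{x ∈ S | x < t} := by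
  rw [shiftSet, filter_map, card_map]
  congr 1; ext x; simp

lemma height_shiftSet : height (shiftSet S) (t + 1) = height S t + 1 := by
  unfold height; rw [card_filter_lt_shiftSet]; push_cast; ring

lemma isRecord_shiftSet : IsRecord (shiftSet S) (t + 1) ↔ IsRecord S t := by
  constructor
  · intro h x hx
    have := h (x + 1) (by omega)
    rw [height_shiftSet, height_shiftSet] at this; omega
  · intro h x hx
    rw [height_shiftSet]
    rcases x with _ | x
    · have := h 0 (by omega); simp [height] at this ⊢; omega
    · rw [height_shiftSet]; have := h x (by omega); omega

lemma isUp_shiftSet : IsUp (shiftSet S) (t + 1) ↔ IsUp S t := by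
  simp [IsUp, isRecord_shiftSet]

lemma isUp_zero : IsUp S 0 ↔ 0 ∉ S := by simp [IsUp, isRecord_zero]

lemma mate_shiftSet (hi : i ∈ S) : mate (shiftSet S) (i + 1) = mate S i + 1 := by
  have hc := isChord_mate hi
  apply IsChord.mate_eq
  refine ⟨by have := hc.1; omega, fun k hk hk' => ?_, ?_⟩
  · obtain ⟨l, rfl⟩ : ∃ l, k = l + 1 := ⟨k - 1, by omega⟩
    rw [height_shiftSet, height_shiftSet]
    have := hc.2.1 l (by omega) (by omega); omega
  · rw [height_shiftSet, height_shiftSet, hc.2.2]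

lemma startsBefore_shiftSet : startsBefore (shiftSet S) (t + 1) = startsBefore S t + 1 := by
  unfold startsBefore upsBefore
  rw [card_filter_lt_shiftSet]
  have : {x ∈ range (t + 1) | IsUp (shiftSet S) x} =
      insert 0 (shiftSet {x ∈ range t | IsUp S x}) := by
    ext x
    rcases x with _ | x
    · simp [isUp_zero]
    · simp [isUp_shiftSet]
  rw [this, card_insert_of_notMem (by simp), card_shiftSet]; ring

lemma chordSize_shiftSet (hi : i ∈ S) : chordSize (shiftSet S) (i + 1) = chordSize S i := by
  unfold chordSize
  rw [mate_shiftSet hi, shiftSet, filter_map, card_map]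
  congr 1; ext x; simp

end Shift

section Scalars

variable {K : Type*} [Field K] {q Q : K} {S T : Finset ℕ} {i j t u x : ℕ}

@[simp] lemma qInt_zero : qInt q 0 = 0 := by simp [qInt]

lemma qInt_add (hq : q ≠ 0) (a m : ℕ) :
    qInt q (a + m) = q ^ m * qInt q a + q ^ (-(a : ℤ)) * qInt q m := by
  unfold qInt
  rw [Finset.sum_range_add, mul_sum, mul_sum]
  congr 1 <;> refine sum_congr rfl fun i _ => ?_
  · rw [← zpow_natCast, ← zpow_add₀ hq]; congr 1; push_cast; ring
  · rw [← zpow_add₀ hq]; congr 1; push_cast; ring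

lemma prod_card_filter_lt {M : Type*} [CommMonoid M] (G : Finset ℕ) (g : ℕ → M) :
    ∏ x ∈ G, g (#{y ∈ G | y < x}) = ∏ k ∈ range (#G), g k := by
  induction G using Finset.induction_on_max with
  | empty => simp
  | insert a s ha ih =>
    have hn : a ∉ s := fun h => lt_irrefl _ (ha a h)
    rw [prod_insert hn, card_insert_of_notMem hn, prod_range_succ, mul_comm, ← ih]
    congr 1
    · refine prod_congr rfl fun x hx => ?_
      congr 2; ext y; simp only [mem_filter, mem_insert]
      constructor
      · rintro ⟨rfl | h, h'⟩
        · exact absurd (ha x hx) (by omega)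
        · exact ⟨h, h'⟩
      · rintro ⟨h, h'⟩; exact ⟨Or.inr h, h'⟩
    · congr 2; ext y; simp only [mem_filter, mem_insert]
      constructor
      · rintro ⟨rfl | h, h'⟩
        · omega
        · exact h
      · intro h; exact ⟨Or.inr h, ha y h⟩

/-- The product over all arcs of label over size, the labels starting from `e`. -/
noncomputable def chordProd (q : K) (e : ℕ) (S : Finset ℕ) : K :=
  ∏ i ∈ S, qInt q (startsBefore S i + e) * (qInt q (chordSize S i))⁻¹

/-- The product over all arcs of their labels, the labels starting from `0` before `t` and from `1`
from `t` on, with a power of `q`. -/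
noncomputable def mixedProd (q : K) (S : Finset ℕ) (t : ℕ) : K :=
  q ^ #{x ∈ S | x < t} * ∏ x ∈ S, qInt q (startsBefore S x + if x < t then 0 else 1)

lemma chord_telescope (hq : q ≠ 0) (h : IsChord S i j) (hi : IsRecord S i) :
    mixedProd q S i = mixedProd q S (j + 1) + q ^ (-(upsBefore S i : ℤ)) * qInt q (chordSize S i) *
      ∏ x ∈ S.erase i, qInt q (startsBefore (S.erase i) x) := by
  have hiS := h.left_mem
  have hij := h.1
  set G : Finset ℕ := {y ∈ S | i < y ∧ y ≤ j} with hG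
  set A : Finset ℕ := {y ∈ S | y < i} with hA
  set B : Finset ℕ := {y ∈ S | j < y} with hB
  have hdec : S = insert i (G ∪ (A ∪ B)) := by
    ext y; simp only [hG, hA, hB, mem_insert, mem_union, mem_filter]
    constructor
    · intro hy
      rcases lt_trichotomy y i with h1 | h1 | h1
      · simp [hy, h1]
      · simp [h1]
      · rcases le_or_gt y j with h2 | h2
        · simp [hy, h1, h2]
        · simp [hy, h2]
    · rintro (rfl | h1 | h1 | h1)
      exacts [hiS, h1.1, h1.1, h1.1]
  have hiG : i ∉ G ∪ (A ∪ B) := by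
    simp only [hG, hA, hB, mem_union, mem_filter]; omega
  have hd1 : Disjoint A B := by
    rw [disjoint_left]; intro y; simp only [hA, hB, mem_filter]; omega
  have hd2 : Disjoint G (A ∪ B) := by
    rw [disjoint_left]; intro y; simp only [hG, hA, hB, mem_filter, mem_union]; omega
  have herase : S.erase i = G ∪ (A ∪ B) := by
    conv_lhs => rw [hdec]
    rw [erase_insert hiG]
  have hprod (f : ℕ → K) : ∏ x ∈ S, f x = f i * ((∏ x ∈ G, f x) *
      ((∏ x ∈ A, f x) * ∏ x ∈ B, f x)) := by
    conv_lhs => rw [hdec]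
    rw [prod_insert hiG, prod_union hd2, prod_union hd1]
  have hprod' (f : ℕ → K) : ∏ x ∈ S.erase i, f x = (∏ x ∈ G, f x) *
      ((∏ x ∈ A, f x) * ∏ x ∈ B, f x) := by
    rw [herase, prod_union hd2, prod_union hd1]
  have hsize : chordSize S i = #G + 1 := by
    unfold chordSize
    rw [h.mate_eq, ← card_insert_of_notMem (a := i) (s := G) (by simp [hG])]
    congr 1; ext y; simp only [hG, mem_filter, mem_insert]
    constructor
    · rintro ⟨h1, h2, h3⟩
      rcases Nat.eq_or_lt_of_le h2 with h4 | h4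
      · exact Or.inl h4.symm
      · exact Or.inr ⟨h1, h4, h3⟩
    · rintro (rfl | h1)
      · exact ⟨hiS, le_rfl, hij.le⟩
      · exact ⟨h1.1, h1.2.1.le, h1.2.2⟩
  have hcount : #{x ∈ S | x < j + 1} = #A + (#G + 1) := by
    rw [← hsize, chordSize, h.mate_eq, ← card_union_of_disjoint]
    · congr 1; ext y; simp only [hA, mem_filter, mem_union]
      constructor
      · rintro ⟨h1, h2⟩
        rcases lt_or_ge y i with h3 | h3
        · exact Or.inl ⟨h1, h3⟩
        · exact Or.inr ⟨h1, h3, by omega⟩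
      · rintro (h1 | h1)
        · exact ⟨h1.1, by omega⟩
        · exact ⟨h1.1, by omega⟩
    · rw [disjoint_left]; intro y; simp only [hA, mem_filter]; omega
  set a := startsBefore S i with ha
  have hau : a = upsBefore S i + #A := rfl
  have hGf (f : ℕ → K) : ∏ x ∈ G, f (startsBefore S x) = ∏ k ∈ range (#G), f (a + 1 + k) := by
    rw [← prod_card_filter_lt G fun k => f (a + 1 + k)]
    refine prod_congr rfl fun x hx => ?_
    have hx' := (mem_filter.1 hx).2
    rw [startsBefore_of_mem_chord h hx'.1 hx'.2]
  unfold mixedProd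
  rw [hprod, hprod, hprod']
  have hA1 : ∏ x ∈ A, qInt q (startsBefore S x + if x < i then 0 else 1) =
      ∏ x ∈ A, qInt q (startsBefore S x) :=
    prod_congr rfl fun x hx => by rw [if_pos (mem_filter.1 hx).2, add_zero]
  have hA2 : ∏ x ∈ A, qInt q (startsBefore S x + if x < j + 1 then 0 else 1) =
      ∏ x ∈ A, qInt q (startsBefore S x) :=
    prod_congr rfl fun x hx => by
      rw [if_pos (by have := (mem_filter.1 hx).2; omega), add_zero]
  have hA3 : ∏ x ∈ A, qInt q (startsBefore (S.erase i) x) = ∏ x ∈ A, qInt q (startsBefore S x) :=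
    prod_congr rfl fun x hx => by
      rw [startsBefore_erase_of_le h hi (by have := (mem_filter.1 hx).2; omega)]
  have hB1 : ∏ x ∈ B, qInt q (startsBefore S x + if x < i then 0 else 1) =
      ∏ x ∈ B, qInt q (startsBefore S x + 1) :=
    prod_congr rfl fun x hx => by rw [if_neg (by have := (mem_filter.1 hx).2; omega)]
  have hB2 : ∏ x ∈ B, qInt q (startsBefore S x + if x < j + 1 then 0 else 1) =
      ∏ x ∈ B, qInt q (startsBefore S x + 1) :=
    prod_congr rfl fun x hx => by rw [if_neg (by have := (mem_filter.1 hx).2; omega)]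
  have hB3 : ∏ x ∈ B, qInt q (startsBefore (S.erase i) x) =
      ∏ x ∈ B, qInt q (startsBefore S x + 1) :=
    prod_congr rfl fun x hx => by rw [startsBefore_erase_of_lt h hi (mem_filter.1 hx).2]
  have hG1 : ∏ x ∈ G, qInt q (startsBefore S x + if x < i then 0 else 1) =
      ∏ k ∈ range (#G), qInt q (a + 1 + k + 1) := by
    rw [← hGf fun k => qInt q (k + 1)]
    exact prod_congr rfl fun x hx => by rw [if_neg (by have := (mem_filter.1 hx).2; omega)]
  have hG2 : ∏ x ∈ G, qInt q (startsBefore S x + if x < j + 1 then 0 else 1) =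
      ∏ k ∈ range (#G), qInt q (a + 1 + k) := by
    rw [← hGf fun k => qInt q k]
    exact prod_congr rfl fun x hx => by
      rw [if_pos (by have := (mem_filter.1 hx).2; omega), add_zero]
  have hG3 : ∏ x ∈ G, qInt q (startsBefore (S.erase i) x) =
      ∏ k ∈ range (#G), qInt q (a + 1 + k) := by
    rw [← hGf fun k => qInt q k]
    exact prod_congr rfl fun x hx => by
      rw [startsBefore_erase_of_le h hi (mem_filter.1 hx).2.2]
  rw [hA1, hA2, hA3, hB1, hB2, hB3, hG1, hG2, hG3, if_neg (lt_irrefl i), if_pos (by omega),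
    hcount, hsize, add_zero]
  have hshift : qInt q (a + 1) * ∏ k ∈ range (#G), qInt q (a + 1 + k + 1) =
      (∏ k ∈ range (#G), qInt q (a + 1 + k)) * qInt q (a + (#G + 1)) := by
    have h1 := prod_range_succ (fun k => qInt q (a + 1 + k)) (#G)
    rw [prod_range_succ'] at h1
    rw [show a + (#G + 1) = a + 1 + #G by ring, ← h1, mul_comm]; rfl
  rw [qInt_add hq a (#G + 1)] at hshift
  have hpow : q ^ #A * q ^ (-(a : ℤ)) = q ^ (-(upsBefore S i : ℤ)) := by
    rw [← zpow_natCast, ← zpow_add₀ hq, hau]; congr 1; push_cast; ring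
  rw [← hpow, pow_add q (#A)]
  generalize (∏ x ∈ A, qInt q (startsBefore S x)) = α
  generalize (∏ x ∈ B, qInt q (startsBefore S x + 1)) = β
  linear_combination (q ^ #A * α * β) * hshift

lemma mixedProd_eq_sum (hq : q ≠ 0) {b : ℕ} (hb : ∀ x ∈ S, x < b) (ht : IsRecord S t) :
    mixedProd q S t = q ^ #S * ∏ x ∈ S, qInt q (startsBefore S x) +
      ∑ i ∈ S with IsRecord S i ∧ t ≤ i, q ^ (-(upsBefore S i : ℤ)) * qInt q (chordSize S i) *
        ∏ x ∈ S.erase i, qInt q (startsBefore (S.erase i) x) := by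
  induction hn : b - t using Nat.strong_induction_on generalizing t with
  | _ n ih =>
    by_cases hbt : b ≤ t
    · have h1 : {i ∈ S | IsRecord S i ∧ t ≤ i} = ∅ := by
        ext x; simp only [mem_filter, notMem_empty, iff_false]
        rintro ⟨h1, _, h2⟩
        have := hb x h1; omega
      have h2 : {x ∈ S | x < t} = S :=
        filter_true_of_mem fun x hx => by have := hb x hx; omega
      rw [h1, sum_empty, add_zero, mixedProd, h2]
      congr 1
      exact prod_congr rfl fun x hx => by rw [if_pos (by have := hb x hx; omega), add_zero]
    · by_cases htS : t ∈ S
      · have hc := isChord_mate htS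
        have hlt := hc.1
        rw [chord_telescope hq hc ht, ih _ (by omega) (hc.isRecord_succ ht) rfl, add_assoc]
        congr 1
        have : {i ∈ S | IsRecord S i ∧ t ≤ i} =
            insert t {i ∈ S | IsRecord S i ∧ mate S t + 1 ≤ i} := by
          ext x; simp only [mem_filter, mem_insert]
          constructor
          · rintro ⟨h1, h2, h3⟩
            rcases Nat.eq_or_lt_of_le h3 with h4 | h4
            · exact Or.inl h4.symm
            · exact Or.inr ⟨h1, h2, hc.lt_of_isRecord h2 h4⟩
          · rintro (rfl | h1)
            · exact ⟨htS, ht, le_rfl⟩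
            · exact ⟨h1.1, h1.2.1, by omega⟩
        rw [this, sum_insert (by simp only [mem_filter]; omega), add_comm]
      · have h1 : mixedProd q S t = mixedProd q S (t + 1) := by
          unfold mixedProd
          rw [card_filter_lt_succ_of_notMem htS]
          congr 1
          refine prod_congr rfl fun x hx => ?_
          have : x ≠ t := fun h => htS (h ▸ hx)
          have h2 : x < t ↔ x < t + 1 := by omega
          simp only [h2]
        rw [h1, ih _ (by omega) (IsUp.isRecord_succ ⟨htS, ht⟩) rfl]
        congr 1
        refine sum_congr ?_ fun _ _ => rfl
        ext x; simp only [mem_filter]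
        refine and_congr_right fun hx => and_congr_right fun _ => ?_
        have : x ≠ t := fun h => htS (h ▸ hx)
        omega

lemma chordProd_one (hq : q ≠ 0) (hne : ∀ i ∈ S, qInt q (chordSize S i) ≠ 0) :
    chordProd q 1 S = q ^ #S * chordProd q 0 S +
      ∑ i ∈ S with IsRecord S i, q ^ (-(upsBefore S i : ℤ)) * chordProd q 0 (S.erase i) := by
  obtain ⟨b, hb⟩ : ∃ b, ∀ x ∈ S, x < b :=
    ⟨S.sup id + 1, fun x hx => Nat.lt_succ_iff.2 (le_sup (f := id) hx)⟩
  have h := mixedProd_eq_sum hq hb (isRecord_zero (S := S))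
  have h0 : mixedProd q S 0 = ∏ x ∈ S, qInt q (startsBefore S x + 1) := by simp [mixedProd]
  rw [h0] at h
  unfold chordProd
  simp only [add_zero, prod_mul_distrib]
  rw [h, add_mul, sum_mul, mul_assoc]
  congr 1
  simp only [zero_le, and_true]
  refine sum_congr rfl fun i hi => ?_
  obtain ⟨hiS, hr⟩ := mem_filter.1 hi
  have h1 : ∏ x ∈ S.erase i, (qInt q (chordSize (S.erase i) x))⁻¹ =
      ∏ x ∈ S.erase i, (qInt q (chordSize S x))⁻¹ :=
    prod_congr rfl fun x hx => by
      rw [chordSize_erase hiS hr (mem_of_mem_erase hx) (ne_of_mem_erase hx)]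
  rw [h1, ← mul_prod_erase S (fun x => (qInt q (chordSize S x))⁻¹) hiS]
  have := hne i hiS
  field_simp

lemma chordProd_zero_of_mem (h : 0 ∈ S) : chordProd q 0 S = 0 := by
  apply prod_eq_zero h
  simp [startsBefore, upsBefore]

lemma chordProd_shiftSet : chordProd q 0 (shiftSet S) = chordProd q 1 S := by
  unfold chordProd
  conv_lhs => rw [shiftSet, prod_map]
  refine prod_congr rfl fun i hi => ?_
  rw [add_zero]
  exact congrArg₂ (fun a b => qInt q a * (qInt q b)⁻¹) startsBefore_shiftSet (chordSize_shiftSet hi)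

/-- The component of the zero mode at the diagram with down arrows at `S ⊆ {0, …, N - 1}`, the
labels starting from `e`. -/
noncomputable def chainCoeff (q Q : K) (e N : ℕ) (S : Finset ℕ) : K :=
  q ^ ((N - #S) * (N - #S - 1) / 2) * Q ^ (N - #S) * chordProd q e S

lemma chainCoeff_succ (hq : q ≠ 0) (hne : ∀ i ∈ S, qInt q (chordSize S i) ≠ 0) {N : ℕ}
    (hS : S ⊆ range (N + 1)) :
    chainCoeff q Q 1 (N + 1) S = Q * q ^ N * chainCoeff q Q 0 N S +
      ∑ i ∈ S with IsRecord S i, q ^ (-(upsBefore S i : ℤ)) * chainCoeff q Q 0 N (S.erase i) := by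
  have h1 : q ^ ((N + 1 - #S) * (N + 1 - #S - 1) / 2) * Q ^ (N + 1 - #S) *
      (q ^ #S * chordProd q 0 S) = Q * q ^ N * chainCoeff q Q 0 N S := by
    rcases Nat.eq_or_lt_of_le (card_range (N + 1) ▸ card_le_card hS) with h | h
    · have h0 : 0 ∈ S := by
        rw [eq_of_subset_of_card_le hS (by rw [h, card_range])]; simp
      rw [chainCoeff, chordProd_zero_of_mem h0]; simp
    · obtain ⟨d, rfl⟩ : ∃ d, N = #S + d := ⟨N - #S, by omega⟩
      rw [chainCoeff, show #S + d + 1 - #S = d + 1 by omega, show #S + d - #S = d by omega,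
        Nat.triangle_succ]
      ring
  unfold chainCoeff at *
  rw [chordProd_one hq hne, mul_add, h1, mul_sum]
  congr 1
  refine sum_congr rfl fun i hi => ?_
  have hiS := (mem_filter.1 hi).1
  have : 0 < #S := card_pos.2 ⟨i, hiS⟩
  rw [card_erase_of_mem hiS, show N - (#S - 1) = N + 1 - #S by omega]
  ring

end Scalars

section Vectors

variable {K : Type*} [Field K] {q Q : K} {S T : Finset ℕ} {i j t u x N : ℕ}

/-- The product over all arcs of the coefficients of `v₋₁ ⊗ v₁ - q⁻¹ v₁ ⊗ v₋₁`, for the standard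
basis vector with down arrows at `T`. -/
noncomputable def chordWeight (q : K) (S T : Finset ℕ) : K :=
  ∏ i ∈ S, arcVec q (if i ∈ T then 1 else 0) (if mate S i ∈ T then 1 else 0)

open Classical in
/-- The coordinate of a Kazhdan–Lusztig basis vector, for the chain continued by up arrows. -/
noncomputable def chainVec (q : K) (S T : Finset ℕ) : K :=
  chordWeight q S T * if ∀ x, IsUp S x → x ∉ T then 1 else 0

open Classical in
/-- The coordinate of a Kazhdan–Lusztig basis vector with the unpaired arrow at `u` reversed. -/
noncomputable def chainVecAt (q : K) (S : Finset ℕ) (u : ℕ) (T : Finset ℕ) : K :=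
  chordWeight q S T * if ∀ x, IsUp S x → (x ∈ T ↔ x = u) then 1 else 0

lemma chainVec_eq_sub (h : IsChord S i j) (hi : IsRecord S i) :
    chainVec q S T = chainVecAt q (S.erase i) i T - q⁻¹ * chainVecAt q (S.erase i) j T := by
  classical
  have hiS := h.left_mem
  have hij := h.1.ne
  have hw : chordWeight q S T =
      arcVec q (if i ∈ T then 1 else 0) (if j ∈ T then 1 else 0) *
        chordWeight q (S.erase i) T := by
    unfold chordWeight
    rw [← mul_prod_erase S _ hiS, h.mate_eq]
    congr 1
    refine prod_congr rfl fun x hx => ?_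
    rw [mate_erase hiS hi (mem_of_mem_erase hx) (ne_of_mem_erase hx)]
  have hni : ¬ IsUp S i := fun h' => h'.1 hiS
  have hnj : ¬ IsUp S j := fun h' => h.not_isRecord h.1 le_rfl h'.2
  have h1 : (∀ x, IsUp (S.erase i) x → (x ∈ T ↔ x = i)) ↔
      (∀ x, IsUp S x → x ∉ T) ∧ i ∈ T ∧ j ∉ T := by
    constructor
    · intro H
      refine ⟨fun x hx => ?_, ?_, ?_⟩
      · rw [H x ((isUp_erase h hi).2 (Or.inl hx))]; rintro rfl; exact hni hx
      · rw [H i ((isUp_erase h hi).2 (by simp))]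
      · rw [H j ((isUp_erase h hi).2 (by simp))]; exact hij.symm
    · rintro ⟨H1, H2, H3⟩ x hx
      rcases (isUp_erase h hi).1 hx with h4 | rfl | rfl
      · have : x ≠ i := by rintro rfl; exact hni h4
        simp [H1 x h4, this]
      · simp [H2]
      · simp [H3, hij.symm]
  have h2 : (∀ x, IsUp (S.erase i) x → (x ∈ T ↔ x = j)) ↔
      (∀ x, IsUp S x → x ∉ T) ∧ i ∉ T ∧ j ∈ T := by
    constructor
    · intro H
      refine ⟨fun x hx => ?_, ?_, ?_⟩
      · rw [H x ((isUp_erase h hi).2 (Or.inl hx))]; rintro rfl; exact hnj hx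
      · rw [H i ((isUp_erase h hi).2 (by simp))]; exact hij
      · rw [H j ((isUp_erase h hi).2 (by simp))]
    · rintro ⟨H1, H2, H3⟩ x hx
      rcases (isUp_erase h hi).1 hx with h4 | rfl | rfl
      · have : x ≠ j := by rintro rfl; exact hnj h4
        simp [H1 x h4, this]
      · simp [H2, hij]
      · simp [H3]
  have ha : arcVec q (if i ∈ T then 1 else 0) (if j ∈ T then 1 else 0) =
      if i ∈ T then if j ∈ T then 0 else 1 else if j ∈ T then -q⁻¹ else 0 := by
    split_ifs <;> simp [arcVec]
  unfold chainVec chainVecAt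
  rw [hw, ha, if_congr h1 rfl rfl, if_congr h2 rfl rfl]
  generalize chordWeight q (S.erase i) T = w
  by_cases hU : ∀ x, IsUp S x → x ∉ T
  · rw [if_pos hU, if_congr (and_iff_right hU) rfl rfl, if_congr (and_iff_right hU) rfl rfl]
    by_cases hiT : i ∈ T <;> by_cases hjT : j ∈ T <;> simp [hiT, hjT]
  · simp [hU]

lemma chainVecAt_eq_sum {b : ℕ} (hT : ∀ x ∈ T, x < b) (hu : IsUp S u) (hq : q ≠ 0) :
    q ^ (-(upsBefore S u : ℤ)) * chainVecAt q S u T =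
      ∑ x ∈ range b with IsUp S x ∧ u ≤ x,
        q ^ (-(upsBefore S x : ℤ)) * chainVec q (insert x S) T := by
  induction hn : b - u using Nat.strong_induction_on generalizing u with
  | _ n ih =>
    by_cases hbu : b ≤ u
    · have h1 : {x ∈ range b | IsUp S x ∧ u ≤ x} = ∅ := by
        ext x; simp only [mem_filter, notMem_empty, iff_false, mem_range]; omega
      have h2 : ¬ ∀ x, IsUp S x → (x ∈ T ↔ x = u) := fun H => by
        have := hT u ((H u hu).2 rfl); omega
      rw [h1, sum_empty, chainVecAt, if_neg h2]; simp
    · have herase : (insert u S).erase u = S := erase_insert hu.1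
      have hc := isChord_mate (mem_insert_self u S)
      have hr : IsRecord (insert u S) u := by
        rw [← isRecord_erase_of_le le_rfl, herase]; exact hu.2
      set j := mate (insert u S) u with hj
      have hlt := hc.1
      have hup (x : ℕ) : IsUp S x ↔ IsUp (insert u S) x ∨ x = u ∨ x = j := by
        rw [← isUp_erase hc hr, herase]
      have hno (x : ℕ) (h1 : u < x) (h2 : x < j) : ¬ IsUp S x := by
        rw [hup]; rintro (h3 | h3 | h3)
        · exact hc.not_isRecord h1 h2.le h3.2
        · omega
        · omega
      have hjup : IsUp S j := (hup j).2 (by simp)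
      have hcount : upsBefore S j = upsBefore S u + 1 := by
        rw [← upsBefore_succ hu]
        exact upsBefore_eq_of_forall_not hlt fun x h1 h2 => hno x h1 h2
      have hset : {x ∈ range b | IsUp S x ∧ u ≤ x} =
          insert u {x ∈ range b | IsUp S x ∧ j ≤ x} := by
        ext x; simp only [mem_filter, mem_insert, mem_range]
        constructor
        · rintro ⟨h1, h2, h3⟩
          rcases Nat.eq_or_lt_of_le h3 with h4 | h4
          · exact Or.inl h4.symm
          · exact Or.inr ⟨h1, h2, not_lt.1 fun h5 => hno x h4 h5 h2⟩
        · rintro (rfl | h1)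
          · exact ⟨by omega, hu, le_rfl⟩
          · exact ⟨h1.1, h1.2.1, by omega⟩
      rw [hset, sum_insert (by simp only [mem_filter]; omega), ← ih _ (by omega) hjup rfl,
        chainVec_eq_sub hc hr, herase, hcount]
      push_cast
      rw [neg_add, zpow_add₀ hq, zpow_neg_one]
      ring

lemma chordWeight_shiftSet {T T' : Finset ℕ} (hT : ∀ x, x + 1 ∈ T ↔ x ∈ T') :
    chordWeight q (shiftSet S) T = chordWeight q S T' := by
  unfold chordWeight
  conv_lhs => rw [shiftSet, prod_map]
  refine prod_congr rfl fun i hi => ?_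
  have h := mate_shiftSet hi
  unfold shiftSet at h
  simp [h, hT]

lemma chainVec_shiftSet {T T' : Finset ℕ} (hT : ∀ x, x + 1 ∈ T ↔ x ∈ T') :
    chainVec q (shiftSet S) T = if 0 ∈ T then 0 else chainVec q S T' := by
  classical
  unfold chainVec
  rw [chordWeight_shiftSet hT]
  have : (∀ x, IsUp (shiftSet S) x → x ∉ T) ↔ 0 ∉ T ∧ ∀ x, IsUp S x → x ∉ T' := by
    constructor
    · intro H
      refine ⟨H 0 (isUp_zero.2 (by simp)), fun x hx => ?_⟩
      rw [← hT]; exact H _ (isUp_shiftSet.2 hx)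
    · rintro ⟨H1, H2⟩ (_ | x) hx
      · exact H1
      · rw [hT]; exact H2 x (isUp_shiftSet.1 hx)
  rw [if_congr this rfl rfl]
  by_cases h0 : 0 ∈ T <;> simp [h0]

lemma chainVecAt_shiftSet {T T' : Finset ℕ} (hT : ∀ x, x + 1 ∈ T ↔ x ∈ T') :
    chainVecAt q (shiftSet S) 0 T = if 0 ∈ T then chainVec q S T' else 0 := by
  classical
  unfold chainVec chainVecAt
  rw [chordWeight_shiftSet hT]
  have : (∀ x, IsUp (shiftSet S) x → (x ∈ T ↔ x = 0)) ↔ 0 ∈ T ∧ ∀ x, IsUp S x → x ∉ T' := by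
    constructor
    · intro H
      refine ⟨(H 0 (isUp_zero.2 (by simp))).2 rfl, fun x hx => ?_⟩
      rw [← hT, H _ (isUp_shiftSet.2 hx)]; omega
    · rintro ⟨H1, H2⟩ (_ | x) hx
      · simp [H1]
      · rw [hT]; simp [H2 x (isUp_shiftSet.1 hx)]
  rw [if_congr this rfl rfl]
  by_cases h0 : 0 ∈ T <;> simp [h0]

lemma chainCoeff_shiftSet : chainCoeff q Q 0 N (shiftSet S) = chainCoeff q Q 1 N S := by
  rw [chainCoeff, chainCoeff, chordProd_shiftSet, card_shiftSet]

lemma chainCoeff_zero_of_mem (h : 0 ∈ S) : chainCoeff q Q 0 N S = 0 := by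
  rw [chainCoeff, chordProd_zero_of_mem h, mul_zero]

lemma sum_powerset_shiftSet {M : Type*} [AddCommMonoid M] (F : Finset ℕ → M)
    (hF : ∀ S, 0 ∈ S → F S = 0) :
    ∑ S ∈ (range N).powerset, F (shiftSet S) = ∑ S ∈ (range (N + 1)).powerset, F S := by
  classical
  rw [← sum_image (s := (range N).powerset) (g := shiftSet)
    (fun _ _ _ _ h => Finset.map_injective _ h)]
  apply sum_subset
  · intro S hS
    obtain ⟨S', hS', rfl⟩ := mem_image.1 hS
    rw [mem_powerset] at hS' ⊢
    rintro (_ | x) hx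
    · simp
    · have := mem_range.1 (hS' (succ_mem_shiftSet.1 hx)); simpa using this
  · intro S hS hS'
    apply hF
    by_contra h0
    apply hS'
    rw [mem_powerset] at hS
    refine mem_image.2 ⟨{x ∈ range N | x + 1 ∈ S}, by simp, ?_⟩
    ext x
    rcases x with _ | x
    · simp [h0]
    · simp only [succ_mem_shiftSet, mem_filter, mem_range, and_iff_right_iff_imp]
      intro hx; have := mem_range.1 (hS hx); omega

lemma sum_powerset_insert {M : Type*} [AddCommMonoid M] (F : Finset ℕ → ℕ → Finset ℕ → M) :
    ∑ S ∈ (range N).powerset, ∑ x ∈ range N with IsUp S x, F S x (insert x S) =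
      ∑ S ∈ (range N).powerset, ∑ x ∈ S with IsRecord S x, F (S.erase x) x S := by
  rw [sum_sigma', sum_sigma']
  refine sum_bij' (fun p _ => ⟨insert p.2 p.1, p.2⟩) (fun p _ => ⟨p.1.erase p.2, p.2⟩)
    ?_ ?_ ?_ ?_ ?_
  · rintro ⟨S, x⟩ h
    simp only [mem_sigma, mem_powerset, mem_filter, mem_range] at h ⊢
    refine ⟨insert_subset (mem_range.2 h.2.1) h.1, mem_insert_self _ _, ?_⟩
    rw [← isRecord_erase_of_le le_rfl, erase_insert h.2.2.1]; exact h.2.2.2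
  · rintro ⟨S, x⟩ h
    simp only [mem_sigma, mem_powerset, mem_filter, mem_range] at h ⊢
    refine ⟨(erase_subset _ _).trans h.1, mem_range.1 (h.1 h.2.1), by simp, ?_⟩
    rw [isRecord_erase_of_le le_rfl]; exact h.2.2
  · rintro ⟨S, x⟩ h
    simp only [mem_sigma, mem_powerset, mem_filter, mem_range] at h ⊢
    simp [erase_insert h.2.2.1]
  · rintro ⟨S, x⟩ h
    simp only [mem_sigma, mem_powerset, mem_filter] at h ⊢
    simp [insert_erase h.2.1]
  · rintro ⟨S, x⟩ h
    simp only [mem_sigma, mem_powerset, mem_filter, mem_range] at h ⊢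
    rw [erase_insert h.2.2.1]

/-- The expansion of the product vector `⨂ᵢ (Q q^{N-1-i} v₁ + v₋₁)`. -/
theorem sum_chainCoeff_mul_chainVec (hq : q ≠ 0) (N : ℕ)
    (hne : ∀ m, 1 ≤ m → m ≤ N → qInt q m ≠ 0) (hT : T ⊆ range N) :
    ∑ S ∈ (range N).powerset, chainCoeff q Q 1 N S * chainVec q S T =
      ∏ i ∈ range N, if i ∈ T then 1 else Q * q ^ (N - 1 - i) := by
  induction N generalizing T with
  | zero =>
    obtain rfl : T = ∅ := by simpa using hT
    simp [chainCoeff, chainVec, chordProd, chordWeight]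
  | succ N ih =>
    set T' : Finset ℕ := {x ∈ range N | x + 1 ∈ T} with hT'def
    have hT' (x : ℕ) : x + 1 ∈ T ↔ x ∈ T' := by
      simp only [hT'def, mem_filter, mem_range, iff_and_self]
      intro hx; have := mem_range.1 (hT hx); omega
    have ih' := ih (T := T') (fun m h1 h2 => hne m h1 (by omega)) (filter_subset _ _)
    have hsize (S : Finset ℕ) (hS : S ∈ (range (N + 1)).powerset) (i : ℕ) (hi : i ∈ S) :
        qInt q (chordSize S i) ≠ 0 := by
      apply hne
      · exact card_pos.2 ⟨i, by simp [hi, (isChord_mate hi).1.le]⟩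
      · exact (card_filter_le _ _).trans (by
          simpa using card_le_card (mem_powerset.1 hS))
    have hprod : ∏ i ∈ range (N + 1), (if i ∈ T then 1 else Q * q ^ (N + 1 - 1 - i)) =
        (∏ i ∈ range N, if i ∈ T' then 1 else Q * q ^ (N - 1 - i)) *
          if 0 ∈ T then 1 else Q * q ^ N := by
      rw [prod_range_succ']
      congr 1
      refine prod_congr rfl fun i _ => ?_
      simp only [hT']
      rw [show N + 1 - 1 - (i + 1) = N - 1 - i by omega]
    rw [hprod, ← ih', sum_mul]
    have h1 (S : Finset ℕ) : chainCoeff q Q 1 N S * chainVec q S T' *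
        (if 0 ∈ T then 1 else Q * q ^ N) = (fun S => Q * q ^ N * chainCoeff q Q 0 N S *
          chainVec q S T + ∑ x ∈ range (N + 1) with IsUp S x, chainCoeff q Q 0 N S *
            (q ^ (-(upsBefore S x : ℤ)) * chainVec q (insert x S) T)) (shiftSet S) := by
      have h2 := chainVecAt_eq_sum (S := shiftSet S) (q := q) (b := N + 1)
        (fun x hx => mem_range.1 (hT hx)) (isUp_zero.2 zero_notMem_shiftSet) hq
      simp only [zero_le, and_true] at h2
      simp only
      rw [← mul_sum, ← h2, chainVec_shiftSet hT', chainVecAt_shiftSet hT', chainCoeff_shiftSet]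
      simp only [upsBefore, range_zero, filter_empty, card_empty, Nat.cast_zero, neg_zero,
        zpow_zero, one_mul]
      by_cases h0 : 0 ∈ T <;> simp [h0]; ring
    simp only [h1]
    rw [sum_powerset_shiftSet (F := fun S => Q * q ^ N * chainCoeff q Q 0 N S *
          chainVec q S T + ∑ x ∈ range (N + 1) with IsUp S x, chainCoeff q Q 0 N S *
            (q ^ (-(upsBefore S x : ℤ)) * chainVec q (insert x S) T))]
    · rw [sum_add_distrib, sum_powerset_insert (F := fun S x S' => chainCoeff q Q 0 N S *
            (q ^ (-(upsBefore S x : ℤ)) * chainVec q S' T)), ← sum_add_distrib]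
      refine sum_congr rfl fun S hS => ?_
      rw [chainCoeff_succ hq (hsize S hS) (mem_powerset.1 hS), add_mul, sum_mul]
      congr 1
      refine sum_congr rfl fun i _ => ?_
      rw [upsBefore_erase_of_le le_rfl]; ring
    · intro S h0
      simp [chainCoeff_zero_of_mem h0]

end Vectors

section Configurations

variable {K : Type*} [Field K] {q Q : K} {N : ℕ} {b κ : Config N} {i j : Fin N} {x : ℕ}

/-- The set of sites carrying a down arrow. -/
def downSet (b : Config N) : Finset ℕ := ({i | b i = 1} : Finset (Fin N)).map Fin.valEmbedding

lemma mem_downSet : x ∈ downSet b ↔ ∃ h : x < N, b ⟨x, h⟩ = 1 := by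
  simp only [downSet, Finset.mem_map, mem_filter, mem_univ, true_and, Fin.valEmbedding_apply]
  constructor
  · rintro ⟨i, hi, rfl⟩; exact ⟨i.2, hi⟩
  · rintro ⟨h, hb⟩; exact ⟨_, hb, rfl⟩

lemma val_mem_downSet : (i : ℕ) ∈ downSet b ↔ b i = 1 := by simp [mem_downSet]

lemma lt_of_mem_downSet (h : x ∈ downSet b) : x < N := (mem_downSet.1 h).1

lemma downSet_subset : downSet b ⊆ range N := fun _ h => mem_range.2 (lt_of_mem_downSet h)

lemma fin_two_ne_one {a : Fin 2} : a ≠ 1 ↔ a = 0 := by omega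

lemma val_notMem_downSet : (i : ℕ) ∉ downSet b ↔ b i = 0 := by
  rw [val_mem_downSet]; exact fin_two_ne_one

lemma ite_val_mem_downSet : (if (i : ℕ) ∈ downSet b then (1 : Fin 2) else 0) = b i := by
  split_ifs with h
  · exact (val_mem_downSet.1 h).symm
  · exact (val_notMem_downSet.1 h).symm

lemma card_filter_downSet (P : ℕ → Prop) [DecidablePred P] :
    #{x ∈ downSet b | P x} = #{i : Fin N | b i = 1 ∧ P i} := by
  rw [downSet, filter_map, card_map, filter_filter]; rfl

lemma numUp_add_numDown : numUp b i j + numDown b i j = (j : ℕ) + 1 - i := by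
  unfold numUp numDown
  have h := card_filter_add_card_filter_not (s := Finset.Icc i j) (fun l => b l = 0)
  rw [Fin.card_Icc] at h
  rw [← h]
  congr 2; ext l; simp only [mem_filter]
  refine and_congr_right fun _ => ?_
  omega

lemma card_filter_lt_downSet (hij : i ≤ j) :
    #{x ∈ downSet b | x < (j : ℕ) + 1} = #{x ∈ downSet b | x < (i : ℕ)} + numDown b i j := by
  rw [card_filter_downSet, card_filter_downSet, numDown, ← card_union_of_disjoint]
  · congr 1; ext l
    simp only [mem_filter, mem_univ, true_and, mem_union, Finset.mem_Icc, Fin.le_def] at *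
    constructor
    · rintro ⟨h1, h2⟩
      rcases lt_or_ge (l : ℕ) i with h | h
      · exact Or.inl ⟨h1, h⟩
      · exact Or.inr ⟨⟨h, by omega⟩, h1⟩
    · rintro (h | h)
      · exact ⟨h.1, by omega⟩
      · exact ⟨h.2, by omega⟩
  · rw [disjoint_left]; intro l
    simp only [mem_filter, mem_univ, true_and, Finset.mem_Icc, Fin.le_def]; omega

lemma height_downSet (hij : i ≤ j) :
    height (downSet b) (j + 1) = height (downSet b) i + numUp b i j - numDown b i j := by
  unfold height
  rw [card_filter_lt_downSet hij]
  have h := numUp_add_numDown (b := b) (i := i) (j := j)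
  rw [Fin.le_def] at hij
  push_cast; omega

lemma isArc_iff_isChord : IsArc b i j ↔ IsChord (downSet b) i j := by
  unfold IsArc IsChord
  refine and_congr_right fun hij => and_congr ?_ ?_
  · constructor
    · intro h k hk hk'
      have h1 := h ⟨k - 1, by omega⟩ (by rw [Fin.le_def]; simp; omega)
        (by rw [Fin.lt_def]; simp; omega)
      have h2 := height_downSet (b := b) (i := i) (j := ⟨k - 1, by omega⟩)
        (by rw [Fin.le_def]; simp; omega)
      simp only [show k - 1 + 1 = k by omega] at h2
      omega
    · intro h k hk hk'
      have h1 := h (k + 1) (by rw [Fin.le_def] at hk; omega) hk'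
      have h2 := height_downSet (b := b) hk
      omega
  · have := height_downSet (b := b) hij.le
    omega

lemma IsArc.left_eq (h : IsArc b i j) : b i = 1 :=
  val_mem_downSet.1 (isArc_iff_isChord.1 h).left_mem

lemma IsArc.right_eq (h : IsArc b i j) : b j = 0 :=
  val_notMem_downSet.1 (isArc_iff_isChord.1 h).right_notMem

lemma IsArc.mate_eq (h : IsArc b i j) : mate (downSet b) i = j := (isArc_iff_isChord.1 h).mate_eq

lemma mem_arcs {p : Fin N × Fin N} : p ∈ arcs b ↔ IsArc b p.1 p.2 := by simp [arcs]

lemma mem_upArrows : i ∈ upArrows b ↔ IsUp (downSet b) i := by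
  simp only [upArrows, mem_filter, mem_univ, true_and]
  constructor
  · rintro ⟨h1, h2⟩
    by_contra h
    obtain ⟨j, hj⟩ := exists_isChord_of_not_isUp (val_notMem_downSet.2 h1) h
    exact h2 ⟨j, lt_of_mem_downSet hj.left_mem⟩ (isArc_iff_isChord.2 hj)
  · rintro ⟨h1, h2⟩
    refine ⟨val_notMem_downSet.1 h1, fun j hj => ?_⟩
    have hc := isArc_iff_isChord.1 hj
    exact hc.not_isRecord hc.1 le_rfl h2

lemma mem_downArrows : i ∈ downArrows b ↔ b i = 1 ∧ N ≤ mate (downSet b) i := by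
  simp only [downArrows, mem_filter, mem_univ, true_and]
  refine and_congr_right fun h1 => ?_
  constructor
  · intro h
    by_contra h2
    exact h ⟨_, not_le.1 h2⟩ (isArc_iff_isChord.2 (isChord_mate (val_mem_downSet.2 h1)))
  · intro h j hj
    have := hj.mate_eq
    omega

/-- Every down arrow is unpaired or the left end of an arc. -/
@[to_additive]
lemma prod_downSet {M : Type*} [CommMonoid M] (F : ℕ → M) :
    ∏ x ∈ downSet b, F x = (∏ p ∈ arcs b, F p.1) * ∏ i ∈ downArrows b, F i := by
  classical
  have hinj : Set.InjOn Prod.fst (arcs b : Set (Fin N × Fin N)) := by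
    rintro ⟨i, j⟩ h ⟨i', j'⟩ h' (rfl : i = i')
    have h1 := (mem_arcs.1 h).mate_eq
    have h2 := (mem_arcs.1 h').mate_eq
    simp only at h1 h2
    rw [h1] at h2
    exact Prod.ext rfl (Fin.ext h2)
  rw [← prod_image (f := fun i : Fin N => F i) hinj, ← prod_union]
  · rw [downSet, prod_map]
    refine prod_congr ?_ fun _ _ => rfl
    ext i
    simp only [mem_filter, mem_univ, true_and, mem_union, mem_image]
    constructor
    · intro h
      by_cases hm : mate (downSet b) i < N
      · exact Or.inl ⟨(i, ⟨_, hm⟩), mem_arcs.2 (isArc_iff_isChord.2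
          (isChord_mate (val_mem_downSet.2 h))), rfl⟩
      · exact Or.inr (mem_downArrows.2 ⟨h, not_lt.1 hm⟩)
    · rintro (⟨p, hp, rfl⟩ | h)
      · exact (mem_arcs.1 hp).left_eq
      · exact (mem_downArrows.1 h).1
  · rw [disjoint_left]
    rintro i hi hi'
    obtain ⟨p, hp, rfl⟩ := mem_image.1 hi
    have := (mem_arcs.1 hp).mate_eq
    have := (mem_downArrows.1 hi').2
    omega

lemma card_filter_downSet_eq (P : ℕ → Prop) [DecidablePred P] :
    #{x ∈ downSet b | P x} = #{p ∈ arcs b | P (p.1 : ℕ)} + #((downArrows b).filter fun i : Fin N => P (i : ℕ)) := by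
  simp only [card_filter]; exact sum_downSet _

lemma card_upArrows_add_card_arcs : #(upArrows b) + #(arcs b) = N - #(downSet b) := by
  classical
  have hinj : Set.InjOn Prod.snd (arcs b : Set (Fin N × Fin N)) := by
    rintro ⟨i, j⟩ h ⟨i', j'⟩ h' (rfl : j = j')
    have h1 := isArc_iff_isChord.1 (mem_arcs.1 h)
    have h2 := isArc_iff_isChord.1 (mem_arcs.1 h')
    simp only at h1 h2
    have h3 := h1.2.2
    have h4 := h2.2.2
    rcases lt_trichotomy (i : ℕ) i' with h5 | h5 | h5
    · have := h1.2.1 i' h5 h2.1.le; omega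
    · exact Prod.ext (Fin.ext h5) rfl
    · have := h2.2.1 i h5 h1.1.le; omega
  have h1 : #{i : Fin N | b i = 0} = #(upArrows b) + #(arcs b) := by
    rw [← card_image_of_injOn hinj, ← card_union_of_disjoint]
    · congr 1; ext j
      simp only [mem_filter, mem_univ, true_and, mem_union, mem_image]
      constructor
      · intro h
        by_cases hu : j ∈ upArrows b
        · exact Or.inl hu
        · simp only [upArrows, mem_filter, mem_univ, true_and, h, not_forall, not_not] at hu
          obtain ⟨i, hi⟩ := hu
          exact Or.inr ⟨(i, j), mem_arcs.2 hi, rfl⟩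
      · rintro (h | ⟨p, hp, rfl⟩)
        · exact val_notMem_downSet.1 (mem_upArrows.1 h).1
        · exact (mem_arcs.1 hp).right_eq
    · rw [disjoint_left]
      rintro i hi hi'
      obtain ⟨p, hp, rfl⟩ := mem_image.1 hi'
      exact (mem_filter.1 hi).2.2 _ (mem_arcs.1 hp)
  have h2 : #(downSet b) = #{i : Fin N | ¬ b i = 0} := by
    rw [downSet, card_map]; congr 1; ext i
    simp only [mem_filter, mem_univ, true_and]; omega
  have h3 := card_filter_add_card_filter_not (s := (univ : Finset (Fin N))) (fun i => b i = 0)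
  rw [card_univ, Fintype.card_fin] at h3
  omega

lemma labelLeft_eq (h : b i = 1) : labelLeft b i = startsBefore (downSet b) i + 1 := by
  have h1 : #{j ∈ upArrows b | j ≤ i} = upsBefore (downSet b) i := by
    unfold upsBefore
    rw [← card_map Fin.valEmbedding]
    congr 1; ext x
    simp only [Finset.mem_map, mem_filter, mem_range, Fin.valEmbedding_apply]
    constructor
    · rintro ⟨j, ⟨h1, h2⟩, rfl⟩
      have h3 := mem_upArrows.1 h1
      refine ⟨lt_of_le_of_ne h2 fun h4 => h3.1 ?_, h3⟩
      rw [h4]; exact val_mem_downSet.2 h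
    · rintro ⟨h1, h2⟩
      exact ⟨⟨x, by omega⟩, ⟨mem_upArrows.2 h2, by rw [Fin.le_def]; exact h1.le⟩, rfl⟩
  have h2 := card_filter_lt_succ_of_mem (val_mem_downSet.2 h)
  have h3 := card_filter_downSet_eq (b := b) (fun x => x < (i : ℕ) + 1)
  simp only [Nat.lt_succ_iff, ← Fin.le_def] at h2 h3
  unfold labelLeft startsBefore
  omega

lemma arcSize_eq {p : Fin N × Fin N} (h : p ∈ arcs b) :
    arcSize p = chordSize (downSet b) p.1 := by
  have hc := isArc_iff_isChord.1 (mem_arcs.1 h)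
  have h1 := hc.2.2
  have h2 : #{x ∈ downSet b | x < (p.2 : ℕ) + 1} =
      #{x ∈ downSet b | x < (p.1 : ℕ)} + chordSize (downSet b) p.1 := by
    rw [chordSize, hc.mate_eq, ← card_union_of_disjoint]
    · congr 1; ext x; simp only [mem_filter, mem_union]
      have := hc.1
      rw [← and_or_left]
      refine and_congr_right fun _ => ?_
      omega
    · rw [disjoint_left]; intro x; simp only [mem_filter]; omega
  unfold height at h1
  rw [h2] at h1
  have := hc.1
  unfold arcSize
  push_cast at h1
  omega

lemma labelRight_eq (h : i ∈ downArrows b) : labelRight b i = chordSize (downSet b) i := by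
  have hi := mem_downArrows.1 h
  have hc := isChord_mate (val_mem_downSet.2 hi.1)
  have h1 : chordSize (downSet b) i = #{x ∈ downSet b | (i : ℕ) ≤ x} := by
    unfold chordSize
    congr 1; ext x; simp only [mem_filter]
    refine and_congr_right fun hx => ?_
    have := lt_of_mem_downSet hx
    omega
  have h2 : {p ∈ arcs b | i ≤ p.2} = {p ∈ arcs b | (i : ℕ) ≤ p.1} := by
    ext p; simp only [mem_filter]
    refine and_congr_right fun hp => ?_
    have hp' := isArc_iff_isChord.1 (mem_arcs.1 hp)
    have hlt := hp'.1
    rw [Fin.le_def]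
    constructor
    · intro h3
      by_contra h4
      have h5 := hp'.2.1 i (by omega) h3
      have h6 := hc.2.1 (p.2 + 1) (by omega) (by omega)
      have := hp'.2.2
      omega
    · intro h3; omega
  rw [h1, card_filter_downSet_eq, labelRight, h2, add_comm]
  rfl

lemma psiCoeff_eq_chainCoeff : psiCoeff q Q b = chainCoeff q Q 1 N (downSet b) := by
  unfold psiCoeff chainCoeff chordProd
  simp only
  rw [card_upArrows_add_card_arcs, prod_downSet]
  have h1 : ∏ p ∈ arcs b, qInt q (startsBefore (downSet b) p.1 + 1) *
      (qInt q (chordSize (downSet b) p.1))⁻¹ =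
      (∏ p ∈ arcs b, qInt q (labelLeft b p.1)) * ∏ p ∈ arcs b, (qInt q (arcSize p))⁻¹ := by
    rw [← prod_mul_distrib]
    refine prod_congr rfl fun p hp => ?_
    rw [labelLeft_eq (mem_arcs.1 hp).left_eq, arcSize_eq hp]
  have h2 : ∏ i ∈ downArrows b, qInt q (startsBefore (downSet b) i + 1) *
      (qInt q (chordSize (downSet b) i))⁻¹ =
      (∏ i ∈ downArrows b, qInt q (labelLeft b i)) *
        ∏ i ∈ downArrows b, (qInt q (labelRight b i))⁻¹ := by
    rw [← prod_mul_distrib]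
    refine prod_congr rfl fun i hi => ?_
    rw [labelLeft_eq (mem_downArrows.1 hi).1, labelRight_eq hi]
  rw [h1, h2]
  ring

lemma klVec_eq_chainVec : klVec q b κ = chainVec q (downSet b) (downSet κ) := by
  classical
  have hd : Disjoint (upArrows b) (downArrows b) := by
    rw [disjoint_left]
    intro i h1 h2
    exact (mem_upArrows.1 h1).1 (val_mem_downSet.2 (mem_downArrows.1 h2).1)
  unfold klVec chainVec chordWeight
  rw [prod_union hd, prod_downSet]
  have h1 : ∏ p ∈ arcs b, arcVec q (κ p.1) (κ p.2) =
      ∏ p ∈ arcs b, arcVec q (if (p.1 : ℕ) ∈ downSet κ then 1 else 0)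
        (if mate (downSet b) p.1 ∈ downSet κ then 1 else 0) :=
    prod_congr rfl fun p hp => by
      rw [(mem_arcs.1 hp).mate_eq, ite_val_mem_downSet, ite_val_mem_downSet]
  have h2 : ∏ i ∈ downArrows b, (if κ i = b i then (1 : K) else 0) =
      ∏ i ∈ downArrows b, arcVec q (if (i : ℕ) ∈ downSet κ then 1 else 0)
        (if mate (downSet b) i ∈ downSet κ then 1 else 0) :=
    prod_congr rfl fun i hi => by
      obtain ⟨hb, hm⟩ := mem_downArrows.1 hi
      rw [ite_val_mem_downSet, if_neg fun h => absurd (lt_of_mem_downSet h) (by omega), hb]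
      rcases eq_or_ne (κ i) 1 with h | h
      · simp [h, arcVec]
      · simp [fin_two_ne_one.1 h, arcVec]
  have h3 : ∏ i ∈ upArrows b, (if κ i = b i then (1 : K) else 0) =
      if ∀ x, IsUp (downSet b) x → x ∉ downSet κ then 1 else 0 := by
    have h4 : (∀ i ∈ upArrows b, κ i = b i) ↔ ∀ x, IsUp (downSet b) x → x ∉ downSet κ := by
      constructor
      · intro H x hx hx'
        have hxN := lt_of_mem_downSet hx'
        have h4 := H ⟨x, hxN⟩ (mem_upArrows.2 hx)
        have h5 : b ⟨x, hxN⟩ = 0 := val_notMem_downSet.1 hx.1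
        rw [h5] at h4
        exact val_notMem_downSet.2 h4 hx'
      · intro H i hi
        have hu := mem_upArrows.1 hi
        rw [val_notMem_downSet.1 hu.1, val_notMem_downSet.1 (H i hu)]
    rw [prod_ite_zero, prod_const_one]
    simp only [h4]
  rw [h1, h2, h3]
  ring

lemma sum_config {M : Type*} [AddCommMonoid M] (F : Finset ℕ → M) :
    ∑ b : Config N, F (downSet b) = ∑ S ∈ (range N).powerset, F S := by
  refine sum_bij' (fun b _ => downSet b) (fun S _ i => if (i : ℕ) ∈ S then 1 else 0)
    ?_ ?_ ?_ ?_ ?_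
  · intro b _; exact mem_powerset.2 downSet_subset
  · intro S _; exact mem_univ _
  · intro b _; ext1 i; exact ite_val_mem_downSet
  · intro S hS
    ext x
    simp only [mem_downSet, ite_eq_left_iff, zero_ne_one, imp_false, not_not]
    exact ⟨fun h => h.2, fun h => ⟨mem_range.1 (mem_powerset.1 hS h), h⟩⟩
  · intro b _; rfl

/-- The product vector `⨂ᵢ (Q q^{N-1-i} v₁ + v₋₁)`. -/
def productVec (N : ℕ) (q Q : K) : Space K N :=
  fun κ => ∏ i : Fin N, if κ i = 1 then 1 else Q * q ^ (N - 1 - (i : ℕ))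

theorem Psi_eq_productVec (hq : q ≠ 0) (hne : ∀ m, 1 ≤ m → m ≤ N → qInt q m ≠ 0) :
    Psi N q Q = productVec N q Q := by
  ext κ
  have h := sum_chainCoeff_mul_chainVec (Q := Q) hq N hne (downSet_subset (b := κ))
  rw [← sum_config, ← Fin.prod_univ_eq_prod_range] at h
  simp only [Psi, klCombination, Finset.sum_apply, Pi.smul_apply, smul_eq_mul,
    psiCoeff_eq_chainCoeff, klVec_eq_chainVec, productVec]
  rw [h]
  simp only [val_mem_downSet]

end Configurations

section ZeroMode

variable {K : Type*} [Field K] {q Q : K} {n N : ℕ}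

lemma sum_eq_zero_of_involutive {α M : Type*} [Fintype α] [AddCommGroup M] (F : α → M) (σ : α → α)
    (hσ : Function.Involutive σ) (h : ∀ a, F a + F (σ a) = 0) (hne : ∀ a, F a ≠ 0 → σ a ≠ a) :
    ∑ a, F a = 0 :=
  Finset.sum_involution (fun a _ => σ a) (fun a _ => h a) (fun a _ => hne a)
    (fun _ _ => mem_univ _) (fun a _ => hσ a)

lemma bulkBlock_diag (x : Fin 2 × Fin 2) (c : Fin 2) : bulkBlock q x (c, c) = 0 := by
  obtain ⟨a, b⟩ := x
  fin_cases a <;> fin_cases b <;> fin_cases c <;> rfl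

lemma bulkBlock_add_swap (hq : q ≠ 0) (x : Fin 2 × Fin 2) (c d : Fin 2) :
    bulkBlock q x (c, d) * (if c = 1 then 1 else q) +
      bulkBlock q x (d, c) * (if d = 1 then 1 else q) = 0 := by
  obtain ⟨a, b⟩ := x
  fin_cases a <;> fin_cases b <;> fin_cases c <;> fin_cases d <;>
    simp [bulkBlock, finProdFinEquiv, hq]

lemma bulkGen_mulVec_productVec (hq : q ≠ 0) (i : Fin n) :
    (bulkGen q i).mulVec (productVec (n + 1) q Q) = 0 := by
  ext κ
  rw [Matrix.mulVec, dotProduct, Pi.zero_apply]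
  have hne : i.castSucc ≠ i.succ := i.castSucc_lt_succ.ne
  set s : Equiv.Perm (Fin (n + 1)) := Equiv.swap i.castSucc i.succ with hs
  have hs1 : s i.castSucc = i.succ := Equiv.swap_apply_left _ _
  have hs2 : s i.succ = i.castSucc := Equiv.swap_apply_right _ _
  have hs3 (k : Fin (n + 1)) (h1 : k ≠ i.castSucc) (h2 : k ≠ i.succ) : s k = k :=
    Equiv.swap_apply_of_ne_of_ne h1 h2
  set R : Config (n + 1) → K := fun κ' => ∏ k ∈ (univ.erase i.castSucc).erase i.succ,
    if κ' k = 1 then 1 else Q * q ^ (n + 1 - 1 - (k : ℕ)) with hR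
  have hprod (κ' : Config (n + 1)) : productVec (n + 1) q Q κ' =
      (if κ' i.castSucc = 1 then 1 else q) *
        ((if κ' i.castSucc = 1 then 1 else Q * q ^ (n - 1 - (i : ℕ))) *
          (if κ' i.succ = 1 then 1 else Q * q ^ (n - 1 - (i : ℕ))) * R κ') := by
    unfold productVec
    rw [← mul_prod_erase univ _ (mem_univ i.castSucc),
      ← mul_prod_erase (univ.erase i.castSucc) _ (mem_erase.2 ⟨hne.symm, mem_univ i.succ⟩)]
    have h1 : n + 1 - 1 - (i.castSucc : ℕ) = n - 1 - (i : ℕ) + 1 := by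
      rw [Fin.val_castSucc]; omega
    have h2 : n + 1 - 1 - (i.succ : ℕ) = n - 1 - (i : ℕ) := by
      rw [Fin.val_succ]; omega
    rw [h1, h2, pow_succ]
    split_ifs <;> ring
  have hRs (κ' : Config (n + 1)) : R (κ' ∘ s) = R κ' := by
    refine prod_congr rfl fun k hk => ?_
    simp only [mem_erase] at hk
    rw [Function.comp_apply, hs3 k hk.2.1 hk.1]
  refine sum_eq_zero_of_involutive _ (fun κ' => κ' ∘ s) ?_ ?_ ?_
  · intro κ'
    ext1 k
    simp [hs]
  · intro κ'
    have hagree : (∀ k, k ≠ i.castSucc → k ≠ i.succ → κ k = κ' (s k)) ↔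
        ∀ k, k ≠ i.castSucc → k ≠ i.succ → κ k = κ' k :=
      forall₃_congr fun k h1 h2 => by rw [hs3 k h1 h2]
    rw [hprod, hprod, hRs]
    simp only [bulkGen, hagree, Function.comp_apply, hs1, hs2]
    have h := bulkBlock_add_swap hq (κ i.castSucc, κ i.succ) (κ' i.castSucc) (κ' i.succ)
    generalize (if ∀ k, k ≠ i.castSucc → k ≠ i.succ → κ k = κ' k then (1 : K) else 0) = w
    linear_combination w * ((if κ' i.castSucc = 1 then 1 else Q * q ^ (n - 1 - (i : ℕ))) *
          (if κ' i.succ = 1 then 1 else Q * q ^ (n - 1 - (i : ℕ))) * R κ') * h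
  · intro κ' hκ' h
    have h1 := congrFun h i.castSucc
    rw [Function.comp_apply, hs1] at h1
    apply hκ'
    rw [bulkGen, h1, bulkBlock_diag]
    ring

lemma boundaryGen_mulVec_productVec (hQ : Q ≠ 0) :
    (boundaryGen Q).mulVec (productVec (n + 1) q Q) = 0 := by
  ext κ
  rw [Matrix.mulVec, dotProduct, Pi.zero_apply]
  have hflip (a : Fin 2) : (1 - a) ≠ a := by omega
  refine sum_eq_zero_of_involutive _
    (fun κ' => Function.update κ' (Fin.last n) (1 - κ' (Fin.last n))) ?_ ?_ ?_
  · intro κ'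
    simp
  · intro κ'
    have hagree : (∀ k, k ≠ Fin.last n → κ k =
        Function.update κ' (Fin.last n) (1 - κ' (Fin.last n)) k) ↔
        ∀ k, k ≠ Fin.last n → κ k = κ' k :=
      forall₂_congr fun k hk => by rw [Function.update_of_ne hk]
    simp only [boundaryGen, hagree, Function.update_self, productVec, Fin.prod_univ_castSucc,
      Function.update_of_ne (Fin.castSucc_lt_last _).ne]
    rcases Fin.exists_fin_two.1 ⟨κ (Fin.last n), rfl⟩ with h | h <;>
    rcases Fin.exists_fin_two.1 ⟨κ' (Fin.last n), rfl⟩ with h' | h' <;>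
    simp [boundaryBlock, h, h'] <;> field_simp <;> split_ifs <;> simp
  · intro κ' _ h
    have := congrFun h (Fin.last n)
    rw [Function.update_self] at this
    exact hflip _ this

lemma productVec_ne_zero : productVec N q Q ≠ 0 := by
  intro h
  have := congrFun h fun _ => 1
  simp [productVec] at this

lemma isZeroMode_productVec (hq : q ≠ 0) (hQ : Q ≠ 0) :
    IsZeroMode n q Q (productVec (n + 1) q Q) := by
  refine ⟨bulkGen_mulVec_productVec hq, boundaryGen_mulVec_productVec hQ, fun a => ?_⟩
  refine ⟨?_, productVec_ne_zero⟩
  rw [Module.End.mem_eigenspace_iff, zero_smul, Matrix.toLin'_apply, hamiltonian,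
    Matrix.sub_mulVec, Matrix.neg_mulVec, Matrix.sum_mulVec, Matrix.smul_mulVec,
    boundaryGen_mulVec_productVec hQ]
  simp [bulkGen_mulVec_productVec hq]

end ZeroMode

section Triangularity

variable {K : Type*} [Field K] {q Q : K} {N : ℕ} {b κ : Config N}

/-- The matrix whose columns are the Kazhdan–Lusztig basis vectors. -/
def klMatrix (N : ℕ) (q : K) : Matrix (Config N) (Config N) K := fun κ b => klVec q b κ

lemma klCombination_eq_mulVec (c : Config N → K) :
    klCombination q c = (klMatrix N q).mulVec c := by
  ext κ
  simp [klCombination, klMatrix, Matrix.mulVec, dotProduct, mul_comm]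

lemma klVec_self : klVec q b b = 1 := by
  unfold klVec
  simp only [if_true, prod_const_one, mul_one]
  refine prod_eq_one fun p hp => ?_
  rw [(mem_arcs.1 hp).left_eq, (mem_arcs.1 hp).right_eq]
  simp [arcVec]

lemma toLex_le_of_klVec_ne_zero (h : klVec q b κ ≠ 0) : toLex κ ≤ toLex b := by
  classical
  rcases eq_or_ne κ b with rfl | hne
  · exact le_rfl
  obtain ⟨h1, h2⟩ := mul_ne_zero_iff.1 h
  rw [prod_ne_zero_iff] at h1 h2
  have hex : ({i | κ i ≠ b i} : Finset (Fin N)).Nonempty := by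
    obtain ⟨i, hi⟩ := Function.ne_iff.1 hne
    exact ⟨i, by simpa using hi⟩
  set i := ({i | κ i ≠ b i} : Finset (Fin N)).min' hex with hidef
  have hi : κ i ≠ b i := by simpa using min'_mem _ hex
  have hmin (j : Fin N) (hj : j < i) : κ j = b j := by
    by_contra hc
    exact absurd (min'_le _ j (by simpa using hc)) (not_le.2 hj)
  have hfree : i ∉ upArrows b ∪ downArrows b := fun hm => by simpa [hi] using h2 i hm
  rw [mem_union, not_or] at hfree
  have hlt : κ i < b i := by
    by_contra hc
    have hb : b i = 0 := by omega
    have hκ : κ i = 1 := by omega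
    have h3 := hfree.1
    simp only [upArrows, mem_filter, mem_univ, true_and, hb, not_forall, not_not] at h3
    obtain ⟨j, hj⟩ := h3
    apply h1 (j, i) (mem_arcs.2 hj)
    simp only [hmin j hj.1, hj.left_eq, hκ]
    simp [arcVec]
  exact le_of_lt ⟨i, hmin, hlt⟩

lemma det_klMatrix : (klMatrix N q).det = 1 := by
  rw [← Matrix.det_submatrix_equiv_self (ofLex : Lex (Config N) ≃ Config N),
    Matrix.det_of_isUpperTriangular]
  · exact prod_eq_one fun b _ => klVec_self
  · intro κ b hlt
    by_contra hne
    exact absurd (toLex_le_of_klVec_ne_zero hne) (not_le.2 hlt)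

lemma psiCoeff_eq_adjugate_mulVec (hq : q ≠ 0) (hne : ∀ m, 1 ≤ m → m ≤ N → qInt q m ≠ 0) :
    psiCoeff q Q = (klMatrix N q).adjugate.mulVec (productVec N q Q) := by
  rw [← Psi_eq_productVec hq hne, Psi, klCombination_eq_mulVec, Matrix.mulVec_mulVec,
    Matrix.adjugate_mul, det_klMatrix, one_smul, Matrix.one_mulVec]

lemma klCombination_adjugate_mulVec (v : Space K N) :
    klCombination q ((klMatrix N q).adjugate.mulVec v) = v := by
  rw [klCombination_eq_mulVec, Matrix.mulVec_mulVec,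
    Matrix.mul_adjugate, det_klMatrix, one_smul, Matrix.one_mulVec]

end Triangularity

section Limits

variable {q Q : ℂ} {N : ℕ}

lemma continuousAt_arcVec (hq : q ≠ 0) (a c : Fin 2) :
    ContinuousAt (fun z : ℂ => arcVec z a c) q := by
  have h : ContinuousAt (fun z : ℂ => -z⁻¹) q := (continuousAt_inv₀ hq).neg
  fin_cases a <;> fin_cases c <;> simp [arcVec] <;> first | exact continuousAt_const | exact h

lemma continuousAt_klMatrix (hq : q ≠ 0) : ContinuousAt (klMatrix N : ℂ → _) q := by
  refine continuousAt_pi.2 fun κ => continuousAt_pi.2 fun b => ?_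
  unfold klMatrix klVec
  refine ContinuousAt.mul ?_ continuousAt_const
  refine tendsto_finsetProd _ fun p _ => ?_
  exact continuousAt_arcVec hq _ _

lemma eventually_qInt_ne_zero (hq : q ≠ 0) {m : ℕ} (hm : 1 ≤ m) :
    ∀ᶠ z in 𝓝[≠] q, qInt z m ≠ 0 := by
  set P : Polynomial ℂ := ∑ i ∈ range m, Polynomial.X ^ (2 * i) with hP
  have hP0 : P ≠ 0 := by
    intro h
    have := congrArg (fun p => Polynomial.coeff p 0) h
    obtain ⟨k, rfl⟩ : ∃ k, m = k + 1 := ⟨m - 1, by omega⟩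
    simp [hP, Finset.sum_range_succ', Polynomial.coeff_X_pow] at this
  have hfin : {z | P.eval z = 0}.Finite := by
    refine (P.roots.toFinset.finite_toSet).subset fun z hz => ?_
    simpa [hP0] using hz
  have h1 : ∀ᶠ z in 𝓝[≠] q, P.eval z ≠ 0 := by
    have := (hfin.subset (Set.sdiff_subset (t := {q}))).isClosed.isOpen_compl.mem_nhds
      (x := q) (by simp)
    filter_upwards [mem_nhdsWithin_of_mem_nhds this, self_mem_nhdsWithin] with z hz hzq hz0
    exact hz ⟨hz0, hzq⟩
  have h2 : ∀ᶠ z in 𝓝[≠] q, z ≠ 0 := mem_nhdsWithin_of_mem_nhds (isOpen_ne.mem_nhds hq)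
  filter_upwards [h1, h2] with z hz hz0 h
  apply hz
  have : P.eval z = z ^ ((m : ℤ) - 1) * qInt z m := by
    rw [hP, Polynomial.eval_finsetSum, qInt, mul_sum, ← sum_range_reflect]
    refine sum_congr rfl fun i hi => ?_
    have := mem_range.1 hi
    rw [Polynomial.eval_pow, Polynomial.eval_X, ← zpow_natCast, ← zpow_add₀ hz0]
    congr 1
    omega
  rw [this, h, mul_zero]

lemma tendsto_psiCoeff (hq : q ≠ 0) (b : Config N) :
    Tendsto (fun z => psiCoeff z Q b) (𝓝[≠] q)
      (𝓝 ((klMatrix N q).adjugate.mulVec (productVec N q Q) b)) := by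
  have hc : ContinuousAt (fun z => (klMatrix N z).adjugate.mulVec (productVec N z Q) b) q := by
    have h1 : ContinuousAt (fun z => (klMatrix N z).adjugate) q :=
      (continuous_id.matrix_adjugate).continuousAt.comp (continuousAt_klMatrix hq)
    have h2 : Continuous (fun z : ℂ => productVec N z Q) := by
      refine continuous_pi fun κ => ?_
      unfold productVec
      refine continuous_finsetProd _ fun i _ => ?_
      split_ifs <;> fun_prop
    refine tendsto_finsetSum _ fun κ _ => ContinuousAt.mul ?_ ?_
    · exact continuousAt_pi.1 (continuousAt_pi.1 h1 b) κ
    · exact continuousAt_pi.1 h2.continuousAt κ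
  refine (hc.tendsto.mono_left nhdsWithin_le_nhds).congr' ?_
  have h1 : ∀ᶠ z in 𝓝[≠] q, ∀ m ∈ Finset.Icc 1 N, qInt z m ≠ 0 :=
    (Filter.eventually_all_finset _).2 fun m hm =>
      eventually_qInt_ne_zero hq (Finset.mem_Icc.1 hm).1
  have h2 : ∀ᶠ z in 𝓝[≠] q, z ≠ 0 := mem_nhdsWithin_of_mem_nhds (isOpen_ne.mem_nhds hq)
  filter_upwards [h1, h2] with z hz hz0
  rw [psiCoeff_eq_adjugate_mulVec hz0 fun m hm hm' => hz m (Finset.mem_Icc.2 ⟨hm, hm'⟩)]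

end Limits

end OneBoundaryTL

theorem mainTheorem5 (n : ℕ) :
    (∀ (K : Type*) [Field K] (q Q : K), q ≠ 0 → Q ≠ 0 →
      (∀ m : ℕ, 1 ≤ m → m ≤ n + 1 → OneBoundaryTL.qInt q m ≠ 0) →
        OneBoundaryTL.IsZeroMode n q Q (OneBoundaryTL.Psi (n + 1) q Q)) ∧
    (∀ q Q : ℂ, q ≠ 0 → Q ≠ 0 →
      ∃ c : OneBoundaryTL.Config (n + 1) → ℂ,
        (∀ b, Tendsto (fun z : ℂ => OneBoundaryTL.psiCoeff z Q b) (𝓝[≠] q) (𝓝 (c b))) ∧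
        OneBoundaryTL.IsZeroMode n q Q (OneBoundaryTL.klCombination q c)) := by
  refine ⟨fun K _ q Q hq hQ hne => ?_, fun q Q hq hQ =>
    ⟨_, OneBoundaryTL.tendsto_psiCoeff hq, ?_⟩⟩
  · rw [OneBoundaryTL.Psi_eq_productVec hq hne]
    exact OneBoundaryTL.isZeroMode_productVec hq hQ
  · rw [OneBoundaryTL.klCombination_adjugate_mulVec]
    exact OneBoundaryTL.isZeroMode_productVec hq hQ
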